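/- Let $\mathcal X$ be a finite alphabet, $M\ge 2$, and let $P_1,\dots,P_M$ be probability mass functions on $\mathcal X$. For each $N$, let $X_1^N,\dots,X_M^N$ be independent training sequences, $X_j^N$ being i.i.d. with law $P_j$; under hypothesis $H_i$ the test samples $Y_1,Y_2,\dots$ are i.i.d. with law $P_i$, independent of the training sequences. Let $\widehat P_{z^n}$ denote the empirical distribution of $z^n$, and let $$\mathrm{GJS}(P,Q,\alpha)=\alpha D(P\|P_\alpha)+D(Q\|P_\alpha),\qquad P_\alpha=\frac{\alpha P+Q}{1+\alpha}.$$ For $\gamma\ge 0$ the sequential test $\Phi^{(M)}_{\mathrm{seq}}(\gamma)$ is defined by $$\Psi_n=\Big\{i\in[M]:\exists\,1\le k\le n,\ k\,\mathrm{GJS}\big(\widehat P_{X_i^N},\widehat P_{Y^k},\tfrac Nk\big)\ge\gamma N\Big\},\qquad T=\inf\{n\ge 1:|\Psi_n|\ge M-1\}\wedge N^2,$$ with terminal decision $d=[M]\setminus\Psi_T$; $H_i$ is declared if and only if $d=\{i\}$ (if $d$ is not a singleton, this counts as an error). For a prior $\pi$ on $[M]$ with $\pi_i>0$ for all $i$ and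 $\sum_i\pi_i=1$, let $$e^\pi(\gamma)=\liminf_{N\to\infty}-\frac1N\log\sum_{i=1}^M\pi_i\,\mathrm P_i(d\ne\{i\})\in[0,\infty]$$ be the Bayesian error exponent of $\Phi^{(M)}_{\mathrm{seq}}(\gamma)$, and call $\gamma\ge0$ an achievable Bayesian error exponent of the scheme if $e^\pi(\gamma)\ge\gamma$. Let $C(P,Q)=-\inf_{0\le\eta\le1}\log\sum_{x}P(x)^\eta Q(x)^{1-\eta}\in[0,\infty]$ be the Chernoff information and $C_{\min}=\min_{i\ne j}C(P_i,P_j)$. Then the supremum of the achievable Bayesian error exponents is $C_{\min}$. More precisely, $e^\pi(\gamma)\ge\gamma$ for every real $\gamma$ with $0\le\gamma<C_{\min}$, and $e^\pi(\gamma)\le C_{\min}<\gamma$ for every real $\gamma>C_{\min}$. If moreover $P_1,\dots,P_M$ all have the same support, then $C_{\min}<\infty$ is itself achievable, i.e. it is the maximum achievable Bayesian error exponent, and $e^\pi(C_{\min})=C_{\min}$. -/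

import Mathlib

namespace SeqClass

/-- Kullback–Leibler divergence (natural logarithm) of two probability mass functions on a finite
alphabet, with `0 log (0 / q) = 0`. It is only used below when `q x = 0` implies `p x = 0`, so it
is always finite. -/
noncomputable def kl {X : Type*} [Fintype X] (p q : X → ℝ) : ℝ :=
  ∑ x, p x * Real.log (p x / q x)

/-- The mixture `P_α = (α P + Q) / (1 + α)`. -/
noncomputable def mix {X : Type*} (p q : X → ℝ) (α : ℝ) : X → ℝ :=
  fun x => (α * p x + q x) / (1 + α)

/-- Generalized Jensen–Shannon divergence
`GJS(P, Q, α) = α D(P ‖ P_α) + D(Q ‖ P_α)`. -/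
noncomputable def gjs {X : Type*} [Fintype X] (p q : X → ℝ) (α : ℝ) : ℝ :=
  α * kl p (mix p q α) + kl q (mix p q α)

open Classical in
/-- The type (empirical distribution) of the first `n` entries of a sequence of length `L`,
used for `1 ≤ n ≤ L`. -/
noncomputable def prefixType {X : Type*} {L : ℕ} (z : Fin L → X) (n : ℕ) : X → ℝ :=
  fun a => ((Finset.univ.filter fun t : Fin L => (t : ℕ) < n ∧ z t = a).card : ℝ) / n

/-- The score `k · GJS(type of X_i^N, type of Y^k, N / k)` of class `i` at time `k`. -/
noncomputable def score {X : Type*} [Fintype X] {M N L : ℕ}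
    (x : Fin M → Fin N → X) (y : Fin L → X) (i : Fin M) (k : ℕ) : ℝ :=
  k * gjs (prefixType (x i) N) (prefixType y k) ((N : ℝ) / k)

open Classical in
/-- `Ψ_n`: the classes whose score has reached the threshold `γ N` at some time `1 ≤ k ≤ n`. -/
noncomputable def crossed {X : Type*} [Fintype X] {M N L : ℕ} (γ : ℝ)
    (x : Fin M → Fin N → X) (y : Fin L → X) (n : ℕ) : Finset (Fin M) :=
  Finset.univ.filter fun i => ∃ k : ℕ, 1 ≤ k ∧ k ≤ n ∧ γ * N ≤ score x y i k

/-- The stopping time `T = inf {n ≥ 1 : |Ψ_n| ≥ M - 1} ∧ N²`. As `T ≤ N²`, only the first `N²` test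
samples matter, and `y` lists exactly these. -/
noncomputable def stopTime {X : Type*} [Fintype X] {M N : ℕ} (γ : ℝ)
    (x : Fin M → Fin N → X) (y : Fin (N ^ 2) → X) : ℕ :=
  sInf (insert (N ^ 2) {n : ℕ | 1 ≤ n ∧ M - 1 ≤ (crossed γ x y n).card})

/-- The terminal decision `[M] \ Ψ_T`. Hypothesis `H_i` is declared exactly when this set
is `{i}`. -/
noncomputable def decision {X : Type*} [Fintype X] {M N : ℕ} (γ : ℝ)
    (x : Fin M → Fin N → X) (y : Fin (N ^ 2) → X) : Finset (Fin M) :=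
  Finset.univ \ crossed γ x y (stopTime γ x y)

/-- The probability `P_i(d ≠ H_i)`: under `H_i` the `j`-th training sequence is i.i.d. `P_j`,
the test sequence is i.i.d. `P_i`, and all the sequences are independent. -/
noncomputable def errProb {X : Type*} [Fintype X] {M : ℕ} (P : Fin M → X → ℝ)
    (γ : ℝ) (N : ℕ) (i : Fin M) : ℝ :=
  ∑ x : Fin M → Fin N → X, ∑ y : Fin (N ^ 2) → X,
    if decision γ x y ≠ {i} then (∏ j, ∏ t, P j (x j t)) * ∏ t, P i (y t) else 0

/-- Average probability of error under the given prior. -/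
noncomputable def bayesErr {X : Type*} [Fintype X] {M : ℕ} (P : Fin M → X → ℝ)
    (prior : Fin M → ℝ) (γ : ℝ) (N : ℕ) : ℝ :=
  ∑ i, prior i * errProb P γ N i

/-- Bayesian error exponent `liminf_{N → ∞} -log(P_err) / N` of the sequential test with
threshold `γ`, as an extended real number (`log 0 = -∞`). -/
noncomputable def bayesianExponent {X : Type*} [Fintype X] {M : ℕ} (P : Fin M → X → ℝ)
    (prior : Fin M → ℝ) (γ : ℝ) : EReal :=
  Filter.liminf
    (fun N : ℕ => (-ENNReal.log (ENNReal.ofReal (bayesErr P prior γ N))) / (N : EReal))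
    Filter.atTop

/-- Chernoff information `- min_{0 ≤ η ≤ 1} log ∑ P^η Q^{1-η}`, as an extended real number: it is
`+∞` when the supports are disjoint. With `0^0 = 1` the sum is `1` at `η = 0, 1`, and the infimum
over `[0, 1]` agrees with the one over the open interval. -/
noncomputable def chernoff {X : Type*} [Fintype X] (p q : X → ℝ) : EReal :=
  -⨅ η ∈ Set.Icc (0 : ℝ) 1,
    ENNReal.log (ENNReal.ofReal (∑ x, p x ^ η * q x ^ (1 - η)))

/-- The smallest pairwise Chernoff information `min_{i ≠ j} C(P_i, P_j)`. -/
noncomputable def minChernoff {X : Type*} [Fintype X] {M : ℕ} (P : Fin M → X → ℝ) : EReal :=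
  ⨅ (i : Fin M) (j : Fin M) (_ : i ≠ j), chernoff (P i) (P j)

/-- The exponents achievable by the scheme: the values `γ ≥ 0` such that the test with
threshold `γ` has Bayesian error exponent at least `γ`. -/
def achievableExponents {X : Type*} [Fintype X] {M : ℕ} (P : Fin M → X → ℝ)
    (prior : Fin M → ℝ) : Set EReal :=
  {r | ∃ γ : ℝ, 0 ≤ γ ∧ r = (γ : EReal) ∧ (γ : EReal) ≤ bayesianExponent P prior γ}

end SeqClass

namespace SeqClass

/-! The exponential of a score is the likelihood of the training and test samples under their own
types, divided by their likelihood under the pooled type (`exp_pairScore`). Likelihoods under own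
types have only polynomial total mass (`sum_prefixProd_prefixType_le`), so exponents can be read off
from likelihood comparisons.

Achievability. Under `H_i` an error requires that class `i` crosses, or that some `j ≠ i` never
does. The pooled type maximises the joint likelihood, so a score of at least `γ N` for class `i`
costs a factor `exp (-γ N)`; the union over `N²` times is harmless. For `j ≠ i`, at time `N²` the
pooled type is essentially `P_i`, so a low score means that the type of the `j`-th training sequence
has divergence at most about `γ` from `P_i`. Tilting with `P_i ^ η * P_j ^ (1 - η)` shows that this
has exponent at least `γ` under `P_j` once that affinity is at most `exp (-γ)`
(`decays_pairProb_pairScore_lt`).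

Converse. If `D(Q ‖ P_i) < γ`, the `j`-th training sequence looks drawn from `Q` with probability
about `exp (-N D(Q ‖ P_j))`; then `P_i` explains it and the test sequence so well that class `j`
never crosses (`bayesianExponent_le_kl`). The normalised tilt at the minimising parameter has both
divergences at most the Chernoff information (`exists_kl_le_of_chernoff_le`). At the threshold
`C_min` itself, with equal supports, moving `Q` slightly towards `P_i` restores the strict
inequality; if `C_min = 0` the test always errs. -/

/-- The product of the weights `r` along the first `n` entries of a sequence. -/
noncomputable def prefixProd {X : Type*} {L : ℕ} (r : X → ℝ) (z : Fin L → X) (n : ℕ) : ℝ :=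
  ∏ t : Fin L with t.val < n, r (z t)

/-! ### Types, maximum likelihood and polynomial mass bounds. -/

section Types

variable {X : Type*} {L : ℕ}

lemma prefixProd_self (r : X → ℝ) (z : Fin L → X) : prefixProd r z L = ∏ t, r (z t) := by
  simp [prefixProd]

lemma prefixProd_nonneg {r : X → ℝ} (hr : ∀ a, 0 ≤ r a) (z : Fin L → X) (n : ℕ) :
    0 ≤ prefixProd r z n :=
  Finset.prod_nonneg fun _ _ => hr _

lemma prefixProd_mono {r s : X → ℝ} (hr : ∀ a, 0 ≤ r a) (h : ∀ a, r a ≤ s a) (z : Fin L → X)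
    (n : ℕ) : prefixProd r z n ≤ prefixProd s z n :=
  Finset.prod_le_prod (fun _ _ => hr _) fun _ _ => h _

lemma prefixProd_mul_compl (r : X → ℝ) (z : Fin L → X) (n : ℕ) :
    prefixProd r z n * ∏ t : Fin L with ¬ t.val < n, r (z t) = ∏ t, r (z t) :=
  Finset.prod_filter_mul_prod_filter_not _ _ _

lemma card_filter_val_lt {n : ℕ} (hn : n ≤ L) :
    (Finset.univ.filter fun t : Fin L => (t : ℕ) < n).card = n := by
  have := Fin.card_filter_val_lt (m := n) (n := L)
  simpa [hn] using this

lemma prefixType_nonneg (z : Fin L → X) (n : ℕ) (a : X) : 0 ≤ prefixType z n a := by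
  unfold prefixType; positivity

lemma prefixType_pos (z : Fin L → X) {n : ℕ} {t : Fin L} (ht : (t : ℕ) < n) :
    0 < prefixType z n (z t) := by
  classical
  unfold prefixType
  have h1 : 0 < n := by omega
  refine div_pos (Nat.cast_pos.2 (Finset.card_pos.2 ⟨t, by simp [ht]⟩)) (by exact_mod_cast h1)

lemma prefixProd_prefixType_pos (z : Fin L → X) (n : ℕ) :
    0 < prefixProd (prefixType z n) z n :=
  Finset.prod_pos fun t ht => prefixType_pos z (by simpa using ht)

variable [Fintype X]

/-- Sums along a prefix are expectations under its type. -/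
lemma sum_prefix (f : X → ℝ) (z : Fin L → X) {n : ℕ} (hn : 1 ≤ n) :
    ∑ t : Fin L with t.val < n, f (z t) = n * ∑ a, prefixType z n a * f a := by
  classical
  have h0 : (n : ℝ) ≠ 0 := by positivity
  rw [← Finset.sum_fiberwise_of_maps_to (g := z) (t := Finset.univ) (fun _ _ => Finset.mem_univ _),
    Finset.mul_sum]
  refine Finset.sum_congr rfl fun a _ => ?_
  rw [Finset.filter_filter, Finset.sum_congr rfl (g := fun _ => f a)]
  · simp only [Finset.sum_const, nsmul_eq_mul, prefixType]
    field_simp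
  · intro t ht
    simp only [Finset.mem_filter] at ht
    rw [ht.2.2]

lemma sum_prefixType (z : Fin L → X) {n : ℕ} (hn : 1 ≤ n) (hL : n ≤ L) :
    ∑ a, prefixType z n a = 1 := by
  have h := sum_prefix (fun _ => 1) z hn
  have h0 : (n : ℝ) ≠ 0 := by positivity
  simp only [Finset.sum_const, card_filter_val_lt hL, nsmul_eq_mul, mul_one] at h
  field_simp at h
  linarith

lemma exp_kl_prefixType (z : Fin L → X) {n : ℕ} (hn : 1 ≤ n) (r : X → ℝ)
    (hr : ∀ t : Fin L, (t : ℕ) < n → 0 < r (z t)) :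
    Real.exp (n * kl (prefixType z n) r) * prefixProd r z n
      = prefixProd (prefixType z n) z n := by
  unfold kl
  rw [← sum_prefix (fun a => Real.log (prefixType z n a / r a)) z hn, Real.exp_sum, prefixProd,
    prefixProd, ← Finset.prod_mul_distrib]
  refine Finset.prod_congr rfl fun t ht => ?_
  have ht' : (t : ℕ) < n := by simpa using ht
  rw [Real.exp_log (div_pos (prefixType_pos z ht') (hr t ht')), div_mul_cancel₀ _ (hr t ht').ne']

/-- Each factor obeys `u ≤ exp (u - 1)` with `u = r / m`. Both maximum-likelihood bounds below
follow, because there the exponent is nonpositive. -/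
lemma prefixProd_le_mul_exp (z : Fin L → X) {n : ℕ} (hn : 1 ≤ n) (hL : n ≤ L) {r m : X → ℝ}
    (hr : ∀ a, 0 ≤ r a) (hm : ∀ t : Fin L, (t : ℕ) < n → 0 < m (z t)) :
    prefixProd r z n
      ≤ prefixProd m z n * Real.exp (n * (∑ a, prefixType z n a * (r a / m a)) - n) := by
  have h1 : (n * (∑ a, prefixType z n a * (r a / m a)) - n : ℝ)
      = ∑ t : Fin L with t.val < n, (r (z t) / m (z t) - 1) := by
    rw [Finset.sum_sub_distrib, sum_prefix (fun a => r a / m a) z hn]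
    simp [card_filter_val_lt hL]
  rw [h1, Real.exp_sum, prefixProd, prefixProd, ← Finset.prod_mul_distrib]
  refine Finset.prod_le_prod (fun _ _ => hr _) fun t ht => ?_
  have ht' := hm t (by simpa using ht)
  have h2 := Real.add_one_le_exp (r (z t) / m (z t) - 1)
  calc r (z t) = m (z t) * (r (z t) / m (z t)) := by field_simp
    _ ≤ _ := mul_le_mul_of_nonneg_left (by linarith) ht'.le

/-- The type maximises the likelihood. -/
lemma prefixProd_le_prefixType (z : Fin L → X) {n : ℕ} (hn : 1 ≤ n) (hL : n ≤ L) {r : X → ℝ}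
    (hr : ∀ a, 0 ≤ r a) (hr1 : ∑ a, r a ≤ 1) :
    prefixProd r z n ≤ prefixProd (prefixType z n) z n := by
  refine (prefixProd_le_mul_exp z hn hL hr fun t ht => prefixType_pos z ht).trans ?_
  refine mul_le_of_le_one_right (prefixProd_prefixType_pos z n).le ?_
  rw [Real.exp_le_one_iff]
  have : ∑ a, prefixType z n a * (r a / prefixType z n a) ≤ 1 := by
    refine (Finset.sum_le_sum fun a _ => ?_).trans hr1
    rcases (prefixType_nonneg z n a).eq_or_lt with h | h
    · simp [← h, hr a]
    · rw [mul_div_cancel₀ _ h.ne']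
  have h0 : (0 : ℝ) ≤ n := by positivity
  nlinarith

/-- The mixture of two types maximises the joint likelihood. -/
lemma prefixProd_mul_le_mix {L' : ℕ} (z : Fin L → X) (y : Fin L' → X) {n k : ℕ} (hn : 1 ≤ n)
    (hL : n ≤ L) (hk : 1 ≤ k) (hL' : k ≤ L') {r : X → ℝ} (hr : ∀ a, 0 ≤ r a)
    (hr1 : ∑ a, r a ≤ 1) :
    prefixProd r z n * prefixProd r y k
      ≤ prefixProd (mix (prefixType z n) (prefixType y k) ((n : ℝ) / k)) z n
        * prefixProd (mix (prefixType z n) (prefixType y k) ((n : ℝ) / k)) y k := by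
  set m := mix (prefixType z n) (prefixType y k) ((n : ℝ) / k) with hm
  have hn0 : (0 : ℝ) < n := by exact_mod_cast hn
  have hk0 : (0 : ℝ) < k := by exact_mod_cast hk
  have hp := prefixType_nonneg z n
  have hq := prefixType_nonneg y k
  have hm0 : ∀ a, 0 ≤ m a := fun a => by
    have := hp a
    have := hq a
    simp only [hm, mix]; positivity
  have hmz : ∀ t : Fin L, (t : ℕ) < n → 0 < m (z t) := fun t ht => by
    have := prefixType_pos z ht
    have := hq (z t)
    simp only [hm, mix]; positivity
  have hmy : ∀ t : Fin L', (t : ℕ) < k → 0 < m (y t) := fun t ht => by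
    have := prefixType_pos y ht
    have := hp (y t)
    simp only [hm, mix]; positivity
  have hma : ∀ a, n * prefixType z n a + k * prefixType y k a = (n + k) * m a := fun a => by
    simp only [hm, mix]; field_simp; ring
  refine (mul_le_mul (prefixProd_le_mul_exp z hn hL hr hmz) (prefixProd_le_mul_exp y hk hL' hr hmy)
    (prefixProd_nonneg hr _ _) (mul_nonneg (prefixProd_nonneg hm0 _ _) (Real.exp_pos _).le)).trans ?_
  rw [mul_mul_mul_comm, ← Real.exp_add]
  refine mul_le_of_le_one_right (mul_nonneg (prefixProd_nonneg hm0 _ _)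
    (prefixProd_nonneg hm0 _ _)) ?_
  rw [Real.exp_le_one_iff]
  have h1 : (n : ℝ) * (∑ a, prefixType z n a * (r a / m a))
      + k * (∑ a, prefixType y k a * (r a / m a)) ≤ n + k := by
    rw [Finset.mul_sum, Finset.mul_sum, ← Finset.sum_add_distrib]
    calc _ ≤ ∑ a, ((n : ℝ) + k) * r a := Finset.sum_le_sum fun a _ => by
          rw [← mul_assoc, ← mul_assoc, ← add_mul, hma]
          rcases (hm0 a).eq_or_lt with h | h
          · have := hr a
            simp only [← h]; simp; positivity
          · rw [mul_assoc, mul_div_cancel₀ _ h.ne']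
      _ = (n + k) * ∑ a, r a := by rw [Finset.mul_sum]
      _ ≤ _ := mul_le_of_le_one_right (by positivity) hr1
  linarith

/-- Shtarkov's bound: the maximised prefix likelihood, completed by a probability mass function,
has at most polynomial total mass. -/
lemma sum_prefixProd_prefixType_le {p : X → ℝ} (hp : p ∈ stdSimplex ℝ X) {n : ℕ} (hn : 1 ≤ n)
    (hL : n ≤ L) :
    ∑ z : Fin L → X, prefixProd (prefixType z n) z n * ∏ t : Fin L with ¬ t.val < n, p (z t)
      ≤ ((n : ℝ) + 1) ^ Fintype.card X := by
  classical
  have hn0 : (n : ℝ) ≠ 0 := by positivity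
  -- Count vectors of total `n`, that is, all candidate types. The product law of such a type,
  -- continued by `p` after time `n`, has mass one, and the type of `z` is among them.
  let C : Finset (X → Fin (n + 1)) := Finset.univ.filter fun c => ∑ a, ((c a : ℕ) : ℝ) = n
  let q : (X → Fin (n + 1)) → X → ℝ := fun c a => ((c a : ℕ) : ℝ) / n
  let w : (X → Fin (n + 1)) → (Fin L → X) → ℝ := fun c z =>
    ∏ t : Fin L, if (t : ℕ) < n then q c (z t) else p (z t)
  have hw : ∀ c z, w c z = prefixProd (q c) z n * ∏ t : Fin L with ¬ t.val < n, p (z t) :=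
    fun c z => Finset.prod_ite _ _
  have hw0 : ∀ c z, 0 ≤ w c z := fun c z => Finset.prod_nonneg fun t _ => by
    have := hp.1 (z t)
    simp only [q]; split_ifs <;> positivity
  have key : ∀ z : Fin L → X, prefixProd (prefixType z n) z n * ∏ t : Fin L with ¬ t.val < n, p (z t)
      ≤ ∑ c ∈ C, w c z := fun z => by
    let c : X → Fin (n + 1) := fun a =>
      ⟨(Finset.univ.filter fun t : Fin L => (t : ℕ) < n ∧ z t = a).card, Nat.lt_succ_of_le <|
        (Finset.card_le_card fun t ht => by simp at ht ⊢; exact ht.1).trans_eq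
          (card_filter_val_lt hL)⟩
    have hq : q c = prefixType z n := by
      funext a; simp only [q, c, prefixType]
    have hc : c ∈ C := by
      have h1 : ∀ a, ((c a : ℕ) : ℝ) = n * q c a := fun a => by simp only [q]; field_simp
      simp only [C, Finset.mem_filter, Finset.mem_univ, true_and]
      simp_rw [h1]
      rw [← Finset.mul_sum, hq, sum_prefixType z hn hL, mul_one]
    rw [← hq, ← hw]
    exact Finset.single_le_sum (f := fun c => w c z) (fun c _ => hw0 c z) hc
  refine (Finset.sum_le_sum fun z _ => key z).trans ?_
  rw [Finset.sum_comm]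
  have h1 : ∀ c ∈ C, ∑ z, w c z = 1 := fun c hc => by
    simp only [w]
    rw [← Fintype.prod_sum (fun (t : Fin L) a => if (t : ℕ) < n then q c a else p a)]
    refine Finset.prod_eq_one fun t _ => ?_
    split_ifs
    · simp only [C, Finset.mem_filter, Finset.mem_univ, true_and] at hc
      simp only [q]; rw [← Finset.sum_div, hc, div_self hn0]
    · exact hp.2
  rw [Finset.sum_congr rfl h1]
  have h2 : C.card ≤ (n + 1) ^ Fintype.card X := by
    refine (Finset.card_le_univ C).trans ?_
    simp
  simpa using (Nat.cast_le (α := ℝ)).2 h2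

lemma sum_prod_prefixType_le {p : X → ℝ} (hp : p ∈ stdSimplex ℝ X) (hL : 1 ≤ L) :
    ∑ z : Fin L → X, prefixProd (prefixType z L) z L ≤ ((L : ℝ) + 1) ^ Fintype.card X := by
  have := sum_prefixProd_prefixType_le hp hL le_rfl
  refine (Finset.sum_congr rfl fun z _ => ?_).trans_le this
  rw [Finset.filter_false_of_mem (fun t _ => not_not.2 t.2), Finset.prod_empty, mul_one]

lemma sum_prod_eq_pow (f : X → ℝ) : ∑ z : Fin L → X, ∏ t, f (z t) = (∑ a, f a) ^ L := by
  rw [← Fintype.prod_sum (fun _ a => f a)]; simp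

lemma sum_prod_eq_one {p : X → ℝ} (hp : p ∈ stdSimplex ℝ X) :
    ∑ z : Fin L → X, ∏ t, p (z t) = 1 := by
  rw [sum_prod_eq_pow, hp.2, one_pow]

end Types

/-! ### The score as a log-likelihood ratio. -/

section Score

variable {X : Type*} {N L : ℕ}

/-- The empirical distribution of the first `k` test samples and the training samples together. -/
noncomputable def pairMix (z : Fin N → X) (y : Fin L → X) (k : ℕ) : X → ℝ :=
  mix (prefixType z N) (prefixType y k) ((N : ℝ) / k)

lemma pairMix_nonneg (z : Fin N → X) (y : Fin L → X) (k : ℕ) (a : X) : 0 ≤ pairMix z y k a := by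
  have := prefixType_nonneg z N a
  have := prefixType_nonneg y k a
  simp only [pairMix, mix]; positivity

variable [Fintype X]

/-- The score of a single training sequence. -/
noncomputable def pairScore (z : Fin N → X) (y : Fin L → X) (k : ℕ) : ℝ :=
  k * gjs (prefixType z N) (prefixType y k) ((N : ℝ) / k)

lemma exp_pairScore (z : Fin N → X) (y : Fin L → X) {k : ℕ} (hN : 1 ≤ N) (hk : 1 ≤ k) :
    Real.exp (pairScore z y k) * (prefixProd (pairMix z y k) z N * prefixProd (pairMix z y k) y k)
      = prefixProd (prefixType z N) z N * prefixProd (prefixType y k) y k := by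
  have hk0 : (0 : ℝ) < k := by exact_mod_cast hk
  have hN0 : (0 : ℝ) < N := by exact_mod_cast hN
  rw [← exp_kl_prefixType z hN (pairMix z y k), ← exp_kl_prefixType y hk (pairMix z y k),
    mul_mul_mul_comm, ← Real.exp_add]
  · congr 2
    simp only [pairScore, gjs, pairMix]
    field_simp
  · intro t ht
    have := prefixType_pos y ht
    have := prefixType_nonneg z N (y t)
    simp only [pairMix, mix]; positivity
  · intro t ht
    have := prefixType_pos z ht
    have := prefixType_nonneg y k (z t)
    simp only [pairMix, mix]; positivity

lemma sum_pairMix (z : Fin N → X) (y : Fin L → X) {k : ℕ} (hN : 1 ≤ N) (hk : 1 ≤ k) (hL : k ≤ L) :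
    ∑ a, pairMix z y k a = 1 := by
  have hk0 : (0 : ℝ) < k := by exact_mod_cast hk
  simp only [pairMix, mix]
  rw [← Finset.sum_div, Finset.sum_add_distrib, ← Finset.mul_sum, sum_prefixType z hN le_rfl,
    sum_prefixType y hk hL]
  field_simp
  ring

/-- A likelihood bound for sequences that score high. -/
lemma prefixProd_mul_le_of_le_pairScore {p : X → ℝ} (hp : p ∈ stdSimplex ℝ X) {z : Fin N → X}
    {y : Fin L → X} {k : ℕ} {s : ℝ} (hN : 1 ≤ N) (hk : 1 ≤ k) (hL : k ≤ L)
    (h : s ≤ pairScore z y k) :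
    prefixProd p z N * prefixProd p y k ≤ Real.exp (-s) *
      (prefixProd (prefixType z N) z N * prefixProd (prefixType y k) y k) := by
  refine (prefixProd_mul_le_mix z y hN le_rfl hk hL hp.1 hp.2.le).trans ?_
  rw [← exp_pairScore z y hN hk, ← mul_assoc, ← Real.exp_add]
  exact le_mul_of_one_le_left (mul_nonneg (prefixProd_nonneg (pairMix_nonneg z y k) _ _)
    (prefixProd_nonneg (pairMix_nonneg z y k) _ _)) (Real.one_le_exp (by linarith))

lemma pairScore_lt_of_prefixProd_lt {p : X → ℝ} (hp : p ∈ stdSimplex ℝ X) {z : Fin N → X}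
    {y : Fin L → X} {k : ℕ} {s : ℝ} (hN : 1 ≤ N) (hk : 1 ≤ k) (hL : k ≤ L)
    (h : prefixProd (prefixType z N) z N * prefixProd (prefixType y k) y k
      < Real.exp s * (prefixProd p z N * prefixProd p y k)) : pairScore z y k < s := by
  by_contra! hs
  have := prefixProd_mul_le_of_le_pairScore hp hN hk hL hs
  have h2 := mul_le_mul_of_nonneg_left this (Real.exp_pos s).le
  rw [← mul_assoc (Real.exp s) (Real.exp (-s)), ← Real.exp_add] at h2
  simp at h2
  linarith

/-- If the score is low, the mixture explains the training sequence well. -/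
lemma prefixProd_le_of_pairScore_lt {z : Fin N → X} {y : Fin L → X} {k : ℕ} {s : ℝ} (hN : 1 ≤ N)
    (hk : 1 ≤ k) (hL : k ≤ L) (h : pairScore z y k < s) :
    prefixProd (prefixType z N) z N ≤ Real.exp s * prefixProd (pairMix z y k) z N := by
  have h0 := pairMix_nonneg z y k
  -- The test prefix is at least as likely under its own type as under the pooled one, so its factor
  -- cancels.
  have h1 := prefixProd_le_prefixType y hk hL h0 (sum_pairMix z y hN hk hL).le
  refine le_of_mul_le_mul_right ?_ (prefixProd_prefixType_pos y k)
  rw [← exp_pairScore z y hN hk, mul_assoc]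
  exact mul_le_mul (Real.exp_le_exp.2 h.le)
    (mul_le_mul_of_nonneg_left h1 (prefixProd_nonneg h0 _ _))
    (mul_nonneg (prefixProd_nonneg h0 _ _) (prefixProd_nonneg h0 _ _)) (Real.exp_pos _).le

/-- A negative score would make the pooled type a better explanation than the own types. This serves
the zero threshold. -/
lemma pairScore_nonneg (z : Fin N → X) (y : Fin L → X) {k : ℕ} (hN : 1 ≤ N)
    (hk : 1 ≤ k) (hL : k ≤ L) : 0 ≤ pairScore z y k := by
  by_contra! h
  have h0 := pairMix_nonneg z y k
  have h1 := sum_pairMix z y hN hk hL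
  have h2 := prefixProd_le_prefixType z hN le_rfl h0 h1.le
  have h3 := prefixProd_le_prefixType y hk hL h0 h1.le
  have h4 := mul_le_mul h2 h3 (prefixProd_nonneg h0 _ _) (prefixProd_prefixType_pos z N).le
  have h5 := mul_pos (prefixProd_prefixType_pos z N) (prefixProd_prefixType_pos y k)
  have h6 := exp_pairScore z y hN hk
  have h7 := Real.exp_lt_one_iff.2 h
  have h8 := Real.exp_pos (pairScore z y k)
  nlinarith

end Score

open Filter Topology

/-! ### Exponential decay up to subexponential factors. -/

section Decay

/-- The sequence `u` decays exponentially with exponent at least `γ`. -/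
def Decays (u : ℕ → ℝ) (γ : ℝ) : Prop :=
  ∀ δ : ℝ, 0 < δ → ∀ᶠ N : ℕ in atTop, u N ≤ Real.exp (-(γ - δ) * N)

lemma eventually_mul_pow_le_exp (K : ℝ) (d : ℕ) {δ : ℝ} (hδ : 0 < δ) :
    ∀ᶠ N : ℕ in atTop, K * (N : ℝ) ^ d ≤ Real.exp (δ * N) := by
  have h := (isLittleO_pow_exp_pos_mul_atTop d hδ).comp_tendsto
    (tendsto_natCast_atTop_atTop (R := ℝ))
  have hK : 0 < (|K| + 1)⁻¹ := by positivity
  filter_upwards [h.bound hK] with N hN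
  simp only [Function.comp_apply, Real.norm_eq_abs, Real.abs_exp] at hN
  rw [inv_mul_eq_div, le_div_iff₀ (by positivity), abs_of_nonneg (by positivity)] at hN
  have h1 : (0 : ℝ) ≤ (N : ℝ) ^ d := by positivity
  nlinarith [le_abs_self K]

variable {u v : ℕ → ℝ} {γ : ℝ}

lemma Decays.mono (hv : Decays v γ) (h : ∀ᶠ N in atTop, u N ≤ v N) : Decays u γ :=
  fun δ hδ => by filter_upwards [hv δ hδ, h] with N h1 h2 using h2.trans h1

lemma Decays.mul_pow (hu : Decays u γ) {K : ℝ} (hK : 0 ≤ K) (d : ℕ) :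
    Decays (fun N => K * (N : ℝ) ^ d * u N) γ := fun δ hδ => by
  filter_upwards [hu (δ / 2) (by positivity), eventually_mul_pow_le_exp K d (half_pos hδ)]
    with N h1 h2
  calc K * (N : ℝ) ^ d * u N ≤ K * (N : ℝ) ^ d * Real.exp (-(γ - δ / 2) * N) :=
        mul_le_mul_of_nonneg_left h1 (by positivity)
    _ ≤ Real.exp (δ / 2 * N) * Real.exp (-(γ - δ / 2) * N) :=
        mul_le_mul_of_nonneg_right h2 (Real.exp_pos _).le
    _ = _ := by rw [← Real.exp_add]; ring_nf

lemma Decays.const_mul (hu : Decays u γ) {K : ℝ} (hK : 0 ≤ K) :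
    Decays (fun N => K * u N) γ := by
  simpa using hu.mul_pow hK 0

lemma Decays.add (hu : Decays u γ) (hv : Decays v γ) : Decays (fun N => u N + v N) γ :=
  fun δ hδ => by
  filter_upwards [hu (δ / 2) (by positivity), hv (δ / 2) (by positivity),
    eventually_mul_pow_le_exp 2 0 (half_pos hδ)] with N h1 h2 h3
  calc u N + v N ≤ 2 * (N : ℝ) ^ 0 * Real.exp (-(γ - δ / 2) * N) := by rw [pow_zero, mul_one]; linarith
    _ ≤ Real.exp (δ / 2 * N) * Real.exp (-(γ - δ / 2) * N) :=
        mul_le_mul_of_nonneg_right h3 (Real.exp_pos _).le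
    _ = _ := by rw [← Real.exp_add]; ring_nf

lemma decays_zero : Decays (fun _ => 0) γ := fun _ _ => .of_forall fun _ => (Real.exp_pos _).le

lemma Decays.sum {ι : Type*} {w : ι → ℕ → ℝ} (s : Finset ι) (h : ∀ i ∈ s, Decays (w i) γ) :
    Decays (fun N => ∑ i ∈ s, w i N) γ := by
  classical
  induction s using Finset.induction_on with
  | empty => simpa using decays_zero
  | insert a s ha ih =>
    simp only [Finset.sum_insert ha]
    exact (h a (Finset.mem_insert_self a s)).add
      (ih fun i hi => h i (Finset.mem_insert_of_mem hi))

lemma decays_exp (γ : ℝ) : Decays (fun N => Real.exp (-γ * N)) γ := fun δ hδ =>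
  .of_forall fun N => Real.exp_le_exp.2 <| by
    have : (0 : ℝ) ≤ N := by positivity
    nlinarith

lemma Decays.of_forall_sub (h : ∀ δ : ℝ, 0 < δ → Decays u (γ - δ)) : Decays u γ := fun δ hδ => by
  filter_upwards [h (δ / 2) (half_pos hδ) (δ / 2) (half_pos hδ)] with N hN
  convert hN using 3; ring

/-- Since `ρ ^ N` tends to zero, its `N`-th power beats every exponential. Hence deviations of the
type of the `N²` test samples are negligible. -/
lemma decays_pow_sq {ρ : ℝ} (h0 : 0 ≤ ρ) (h1 : ρ < 1) (γ : ℝ) :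
    Decays (fun N => ρ ^ N ^ 2) γ := by
  refine (decays_exp γ).mono ?_
  filter_upwards [(tendsto_pow_atTop_nhds_zero_of_lt_one h0 h1).eventually
    (eventually_le_nhds (Real.exp_pos (-γ)))] with N hN
  rw [sq, pow_mul, mul_comm (-γ), Real.exp_nat_mul]
  exact pow_le_pow_left₀ (pow_nonneg h0 _) hN _

/-- The exponent of a sequence that decays with exponent `γ` is at least `γ`. -/
lemma Decays.le_liminf (hu : Decays u γ) :
    (γ : EReal) ≤ liminf (fun N : ℕ => (-ENNReal.log (ENNReal.ofReal (u N))) / (N : EReal))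
      atTop := by
  rw [← EReal.ge_of_forall_gt_iff_ge]
  intro c hc
  refine le_liminf_of_le (by isBoundedDefault) ?_
  have hc' : 0 < γ - c := sub_pos.2 (EReal.coe_lt_coe_iff.1 hc)
  filter_upwards [hu _ hc', eventually_ge_atTop 1] with N hN hN1
  rw [EReal.le_div_iff_mul_le (by exact_mod_cast hN1) (EReal.natCast_ne_top N),
    EReal.le_neg]
  refine (ENNReal.log_monotone (ENNReal.ofReal_le_ofReal hN)).trans ?_
  rw [ENNReal.log_ofReal_of_pos (Real.exp_pos _), Real.log_exp]
  have : ((c : EReal) * (N : EReal)) = ((c * N : ℝ) : EReal) := by push_cast; rfl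
  rw [this, ← EReal.coe_neg, EReal.coe_le_coe_iff]
  linarith

lemma liminf_le_of_eventually_exp_le {D : ℝ}
    (h : ∀ δ : ℝ, 0 < δ → ∀ᶠ N : ℕ in atTop, Real.exp (-(D + δ) * N) ≤ u N) :
    liminf (fun N : ℕ => (-ENNReal.log (ENNReal.ofReal (u N))) / (N : EReal)) atTop ≤ (D : EReal) := by
  rw [← EReal.le_of_forall_lt_iff_le]
  intro c hc
  refine liminf_le_of_frequently_le' (Eventually.frequently ?_)
  have hc' : 0 < c - D := sub_pos.2 (EReal.coe_lt_coe_iff.1 hc)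
  filter_upwards [h _ hc', eventually_ge_atTop 1] with N hN hN1
  rw [EReal.div_le_iff_le_mul (by exact_mod_cast hN1) (EReal.natCast_ne_top N),
    EReal.neg_le]
  refine le_trans ?_ (ENNReal.log_monotone (ENNReal.ofReal_le_ofReal hN))
  rw [ENNReal.log_ofReal_of_pos (Real.exp_pos _), Real.log_exp]
  have : ((N : EReal) * (c : EReal)) = ((N * c : ℝ) : EReal) := by push_cast; rfl
  rw [this, ← EReal.coe_neg, EReal.coe_le_coe_iff]
  linarith

end Decay

/-! ### Large deviations of empirical means. -/

section Chernoff

variable {X : Type*} [Fintype X]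

open Classical in
/-- Exponential Markov bound for the empirical mean of independent samples. -/
lemma exists_sum_indicator_le_pow {p : X → ℝ} (hp : p ∈ stdSimplex ℝ X) (f : X → ℝ) {c : ℝ}
    (hc : ∑ a, p a * f a < c) :
    ∃ ρ : ℝ, 0 ≤ ρ ∧ ρ < 1 ∧ ∀ L : ℕ, ∑ y : Fin L → X,
      (if c * L ≤ ∑ t, f (y t) then ∏ t, p (y t) else 0) ≤ ρ ^ L := by
  -- The moment generating function of `f - c` equals one at zero and has negative slope there, so
  -- it is below one at some `s > 0`; its value there is `ρ`.
  have hd : HasDerivAt (fun s : ℝ => ∑ a, p a * Real.exp (s * (f a - c)))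
      (∑ a, p a * (Real.exp (0 * (f a - c)) * (1 * (f a - c)))) 0 :=
    HasDerivAt.fun_sum fun a _ =>
      (((hasDerivAt_id (0 : ℝ)).mul_const (f a - c)).exp).const_mul (p a)
  have hneg : ∑ a, p a * (Real.exp (0 * (f a - c)) * (1 * (f a - c))) < 0 := by
    simp only [zero_mul, Real.exp_zero, one_mul]
    simp only [mul_sub, Finset.sum_sub_distrib]
    rw [← Finset.sum_mul, hp.2]; linarith
  obtain ⟨s, hs, hs0⟩ := ((hd.tendsto_slope_zero_right.eventually
    (eventually_lt_nhds hneg)).and self_mem_nhdsWithin).exists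
  have hs0 : 0 < s := hs0
  refine ⟨∑ a, p a * Real.exp (s * (f a - c)), Finset.sum_nonneg fun a _ =>
    mul_nonneg (hp.1 a) (Real.exp_pos _).le, ?_, fun L => ?_⟩
  · simp only [zero_add, smul_eq_mul, zero_mul, Real.exp_zero, mul_one, hp.2] at hs
    by_contra! h
    exact hs.not_ge (mul_nonneg (inv_nonneg.2 hs0.le) (by linarith))
  · rw [← sum_prod_eq_pow]
    refine Finset.sum_le_sum fun y _ => ?_
    rw [Finset.prod_mul_distrib, ← Real.exp_sum]
    have h0 : 0 ≤ ∏ t, p (y t) := Finset.prod_nonneg fun t _ => hp.1 _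
    split_ifs with h
    · refine le_mul_of_one_le_right h0 (Real.one_le_exp ?_)
      rw [← Finset.mul_sum, Finset.sum_sub_distrib]
      simp only [Finset.sum_const, Finset.card_univ, Fintype.card_fin, nsmul_eq_mul]
      exact mul_nonneg hs0.le (by linarith)
    · exact mul_nonneg h0 (Real.exp_pos _).le

-- Upward deviations suffice: the test type is later used only through an upper bound on the pooled
-- type.
open Classical in
lemma exists_sum_prefixType_le_pow {p : X → ℝ} (hp : p ∈ stdSimplex ℝ X) (a : X) {ε : ℝ}
    (hε : 0 < ε) :
    ∃ ρ : ℝ, 0 ≤ ρ ∧ ρ < 1 ∧ ∀ L : ℕ, 1 ≤ L → ∑ y : Fin L → X,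
      (if p a + ε < prefixType y L a then ∏ t, p (y t) else 0) ≤ ρ ^ L := by
  obtain ⟨ρ, h0, h1, h⟩ := exists_sum_indicator_le_pow hp (fun b => if b = a then 1 else 0)
    (c := p a + ε) (by simpa using hε)
  refine ⟨ρ, h0, h1, fun L hL => (Finset.sum_le_sum fun y _ => ?_).trans (h L)⟩
  have h2 := sum_prefix (fun b => if b = a then (1 : ℝ) else 0) y hL
  simp only [Fin.is_lt, Finset.filter_true, mul_ite, mul_one, mul_zero, Finset.sum_ite_eq',
    Finset.mem_univ, if_true] at h2
  have h3 : 0 ≤ ∏ t, p (y t) := Finset.prod_nonneg fun t _ => hp.1 _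
  have hL0 : (0 : ℝ) < L := by exact_mod_cast hL
  split_ifs with h4 h5
  · rfl
  · exact absurd (by rw [h2]; nlinarith) h5
  · exact h3
  · rfl

end Chernoff

/-! ### Reduction of the error to events about one training sequence and the test sequence. -/

section ErrorProbability

open Classical in
/-- The probability of an event about one training sequence with law `p` and the test sequence with
law `q`. -/
noncomputable def pairProb {X : Type*} [Fintype X] {N L : ℕ} (p q : X → ℝ)
    (E : (Fin N → X) → (Fin L → X) → Prop) : ℝ :=
  ∑ z, ∑ y, if E z y then (∏ t, p (z t)) * ∏ t, q (y t) else 0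

/-- Marginalisation: the coordinates other than `j` integrate to one. -/
lemma sum_eval_mul_prod {ι Z : Type*} [Fintype ι] [Fintype Z] [DecidableEq ι]
    {w : ι → Z → ℝ} {j : ι} (h : ∀ l ≠ j, ∑ z, w l z = 1) (g : Z → ℝ) :
    ∑ x : ι → Z, g (x j) * ∏ l, w l (x l) = ∑ z, g z * w j z := by
  have h1 : ∀ x : ι → Z, g (x j) * ∏ l, w l (x l)
      = ∏ l, (Function.update w j fun z => g z * w j z) l (x l) := fun x => by
    rw [← Finset.mul_prod_erase _ _ (Finset.mem_univ j),
      ← Finset.mul_prod_erase _ _ (Finset.mem_univ j), Function.update_self, mul_assoc]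
    congr 2
    refine Finset.prod_congr rfl fun l hl => ?_
    rw [Function.update_of_ne (Finset.ne_of_mem_erase hl)]
  simp_rw [h1]
  rw [← Fintype.prod_sum (Function.update w j fun z => g z * w j z), Finset.prod_eq_single j]
  · rw [Function.update_self]
  · intro l _ hl
    rw [Function.update_of_ne hl, h l hl]
  · simp

variable {X : Type*} [Fintype X] {M N L : ℕ} {P : Fin M → X → ℝ}

open Classical in
lemma sum_pair_event (hP : ∀ i, P i ∈ stdSimplex ℝ X) (i j : Fin M)
    (E : (Fin N → X) → (Fin L → X) → Prop) :
    ∑ x : Fin M → Fin N → X, ∑ y : Fin L → X,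
      (if E (x j) y then (∏ l, ∏ t, P l (x l t)) * ∏ t, P i (y t) else 0)
      = pairProb (P j) (P i) E := by
  rw [pairProb, Finset.sum_comm, Finset.sum_comm (γ := Fin N → X)]
  refine Finset.sum_congr rfl fun y _ => ?_
  have := sum_eval_mul_prod (w := fun l (z : Fin N → X) => ∏ t, P l (z t)) (j := j)
    (fun l _ => sum_prod_eq_one (hP l)) (fun z => if E z y then ∏ t, P i (y t) else 0)
  convert this using 2 <;> split_ifs <;> ring

lemma exists_of_decision_ne {γ : ℝ} (hN : 1 ≤ N) {x : Fin M → Fin N → X}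
    {y : Fin (N ^ 2) → X} {i : Fin M} (h : decision γ x y ≠ {i}) :
    (∃ k ∈ Finset.Icc 1 (N ^ 2), γ * N ≤ pairScore (x i) y k) ∨
      ∃ j ∈ Finset.univ.erase i, pairScore (x j) y (N ^ 2) < γ * N := by
  classical
  have hT : stopTime γ x y ≤ N ^ 2 := Nat.sInf_le (Set.mem_insert _ _)
  have hmem : stopTime γ x y ∈ insert (N ^ 2)
      {n : ℕ | 1 ≤ n ∧ M - 1 ≤ (crossed γ x y n).card} :=
    Nat.sInf_mem (Set.insert_nonempty _ _)
  by_contra! hcon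
  obtain ⟨h1, h2⟩ := hcon
  have hi : i ∉ crossed γ x y (stopTime γ x y) := fun hi => by
    simp only [crossed, Finset.mem_filter, Finset.mem_univ, true_and] at hi
    obtain ⟨k, hk1, hk2, hk3⟩ := hi
    exact (h1 k (Finset.mem_Icc.2 ⟨hk1, hk2.trans hT⟩)).not_ge hk3
  have hsub : crossed γ x y (stopTime γ x y) ⊆ Finset.univ.erase i := fun l hl =>
    Finset.mem_erase.2 ⟨fun e => hi (e ▸ hl), Finset.mem_univ _⟩
  have heq : crossed γ x y (stopTime γ x y) = Finset.univ.erase i := by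
    -- Either the cap `N²` is reached, by which time every wrong class has crossed, or at least `M -
    -- 1` classes have crossed; as `i` is not among them, they are all the others.
    rcases hmem with h3 | ⟨-, h3⟩
    · refine hsub.antisymm fun j hj => ?_
      simp only [crossed, Finset.mem_filter, Finset.mem_univ, true_and]
      exact ⟨N ^ 2, Nat.one_le_pow _ _ hN, h3.ge, h2 j hj⟩
    · refine Finset.eq_of_subset_of_card_le hsub ?_
      simpa using h3
  apply h
  rw [decision, heq]
  ext l
  simp

lemma errProb_le (hP : ∀ i, P i ∈ stdSimplex ℝ X) (γ : ℝ) (hN : 1 ≤ N) (i : Fin M) :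
    errProb P γ N i ≤
      ∑ k ∈ Finset.Icc 1 (N ^ 2), pairProb (P i) (P i)
        (fun (z : Fin N → X) (y : Fin (N ^ 2) → X) => γ * N ≤ pairScore z y k)
      + ∑ j ∈ Finset.univ.erase i, pairProb (P j) (P i)
        (fun (z : Fin N → X) (y : Fin (N ^ 2) → X) => pairScore z y (N ^ 2) < γ * N) := by
  classical
  simp_rw [← sum_pair_event hP i]
  rw [Finset.sum_comm, Finset.sum_comm (s := Finset.univ.erase i), ← Finset.sum_add_distrib]
  refine Finset.sum_le_sum fun x _ => ?_
  rw [Finset.sum_comm, Finset.sum_comm (s := Finset.univ.erase i), ← Finset.sum_add_distrib]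
  refine Finset.sum_le_sum fun y _ => ?_
  set W := (∏ l, ∏ t, P l (x l t)) * ∏ t, P i (y t)
  have hW : 0 ≤ W := mul_nonneg (Finset.prod_nonneg fun l _ => Finset.prod_nonneg fun _ _ =>
    (hP l).1 _) (Finset.prod_nonneg fun _ _ => (hP i).1 _)
  have hs1 := fun k => show 0 ≤ (if γ * N ≤ pairScore (x i) y k then W else 0) by
    split_ifs <;> simp [hW]
  have hs2 := fun j => show 0 ≤ (if pairScore (x j) y (N ^ 2) < γ * N then W else 0) by
    split_ifs <;> simp [hW]
  have hS1 : 0 ≤ ∑ k ∈ Finset.Icc 1 (N ^ 2), (if γ * N ≤ pairScore (x i) y k then W else 0) :=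
    Finset.sum_nonneg fun k _ => hs1 k
  have hS2 : 0 ≤ ∑ j ∈ Finset.univ.erase i,
      (if pairScore (x j) y (N ^ 2) < γ * N then W else 0) :=
    Finset.sum_nonneg fun j _ => hs2 j
  split_ifs with h
  · rcases exists_of_decision_ne hN h with ⟨k, hk, h1⟩ | ⟨j, hj, h1⟩
    · have := Finset.single_le_sum (fun k _ => hs1 k) hk
      rw [if_pos h1] at this
      linarith
    · have := Finset.single_le_sum (fun j _ => hs2 j) hj
      rw [if_pos h1] at this
      linarith
  · positivity

/-- A class that never crosses stays in the decision, whatever the other classes do. -/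
lemma pairProb_le_errProb (hP : ∀ i, P i ∈ stdSimplex ℝ X) (γ : ℝ) {i j : Fin M} (hij : i ≠ j) :
    pairProb (P j) (P i) (fun (z : Fin N → X) (y : Fin (N ^ 2) → X) =>
      ∀ k, 1 ≤ k → k ≤ N ^ 2 → pairScore z y k < γ * N) ≤ errProb P γ N i := by
  classical
  rw [← sum_pair_event hP]
  refine Finset.sum_le_sum fun x _ => Finset.sum_le_sum fun y _ => ?_
  have hW : 0 ≤ (∏ l, ∏ t, P l (x l t)) * ∏ t, P i (y t) :=
    mul_nonneg (Finset.prod_nonneg fun l _ => Finset.prod_nonneg fun _ _ =>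
    (hP l).1 _) (Finset.prod_nonneg fun _ _ => (hP i).1 _)
  split_ifs with h1 h2 h2
  · rfl
  · exfalso
    have hT : stopTime γ x y ≤ N ^ 2 := Nat.sInf_le (Set.mem_insert _ _)
    have hj : j ∈ decision γ x y := by
      simp only [decision, Finset.mem_sdiff, Finset.mem_univ, true_and, crossed,
        Finset.mem_filter, not_exists, not_and, not_le]
      exact fun k hk hk' => h1 k hk (hk'.trans hT)
    rw [not_not.1 h2] at hj
    exact hij (Finset.mem_singleton.1 hj).symm
  · exact hW
  · rfl

lemma errProb_nonneg (hP : ∀ i, P i ∈ stdSimplex ℝ X) (γ : ℝ) (i : Fin M) :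
    0 ≤ errProb P γ N i :=
  Finset.sum_nonneg fun x _ => Finset.sum_nonneg fun y _ => by
    have hW : 0 ≤ (∏ l, ∏ t, P l (x l t)) * ∏ t, P i (y t) :=
      mul_nonneg (Finset.prod_nonneg fun l _ => Finset.prod_nonneg fun _ _ =>
      (hP l).1 _) (Finset.prod_nonneg fun _ _ => (hP i).1 _)
    split_ifs <;> simp [hW]

lemma sum_weight_eq_one (hP : ∀ i, P i ∈ stdSimplex ℝ X) (i : Fin M) :
    ∑ x : Fin M → Fin N → X, ∑ y : Fin L → X, (∏ l, ∏ t, P l (x l t)) * ∏ t, P i (y t) = 1 := by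
  simp_rw [← Finset.mul_sum, sum_prod_eq_one (hP i), mul_one]
  rw [← Fintype.prod_sum (fun l (z : Fin N → X) => ∏ t, P l (z t))]
  simp [sum_prod_eq_one (hP _)]

lemma errProb_le_one (hP : ∀ i, P i ∈ stdSimplex ℝ X) (γ : ℝ) (i : Fin M) :
    errProb P γ N i ≤ 1 := by
  rw [← sum_weight_eq_one (N := N) (L := N ^ 2) hP i]
  refine Finset.sum_le_sum fun x _ => Finset.sum_le_sum fun y _ => ?_
  have hW : 0 ≤ (∏ l, ∏ t, P l (x l t)) * ∏ t, P i (y t) :=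
    mul_nonneg (Finset.prod_nonneg fun l _ => Finset.prod_nonneg fun _ _ =>
    (hP l).1 _) (Finset.prod_nonneg fun _ _ => (hP i).1 _)
  split_ifs <;> simp [hW]

end ErrorProbability
-- Achievability.
section Achievability

variable {X : Type*} [Fintype X] {N L : ℕ}

/-- A class whose training and test samples have the same law rarely reaches the threshold. -/
lemma pairProb_le_pairScore_le {p : X → ℝ} (hp : p ∈ stdSimplex ℝ X) {k : ℕ} (s : ℝ) (hN : 1 ≤ N)
    (hk : 1 ≤ k) (hL : k ≤ L) :
    pairProb p p (fun (z : Fin N → X) (y : Fin L → X) => s ≤ pairScore z y k)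
      ≤ Real.exp (-s) *
        (((N : ℝ) + 1) ^ Fintype.card X * ((k : ℝ) + 1) ^ Fintype.card X) := by
  classical
  -- Passing from `p` to the own types gains `exp (-s)`; test samples after time `k` keep the law
  -- `p`. The double sum then factors into two polynomially bounded sums.
  calc pairProb p p (fun (z : Fin N → X) (y : Fin L → X) => s ≤ pairScore z y k)
      ≤ ∑ z : Fin N → X, ∑ y : Fin L → X, Real.exp (-s) * (prefixProd (prefixType z N) z N *
          (prefixProd (prefixType y k) y k * ∏ t : Fin L with ¬ t.val < k, p (y t))) := by
        refine Finset.sum_le_sum fun z _ => Finset.sum_le_sum fun y _ => ?_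
        have h0 : 0 ≤ ∏ t : Fin L with ¬ t.val < k, p (y t) :=
          Finset.prod_nonneg fun _ _ => hp.1 _
        split_ifs with h
        · rw [← prefixProd_self, ← prefixProd_mul_compl p y k]
          have := mul_le_mul_of_nonneg_right
            (prefixProd_mul_le_of_le_pairScore hp hN hk hL h) h0
          calc _ = _ := (mul_assoc _ _ _).symm
            _ ≤ _ := this
            _ = _ := by ring
        · have := prefixProd_prefixType_pos z N
          have := prefixProd_prefixType_pos y k
          positivity
    _ = Real.exp (-s) * ((∑ z : Fin N → X, prefixProd (prefixType z N) z N) *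
          ∑ y : Fin L → X,
            prefixProd (prefixType y k) y k * ∏ t : Fin L with ¬ t.val < k, p (y t)) := by
        rw [Finset.sum_mul_sum]
        simp_rw [Finset.mul_sum]
    _ ≤ _ := by
        refine mul_le_mul_of_nonneg_left (mul_le_mul (sum_prod_prefixType_le hp hN)
          (sum_prefixProd_prefixType_le hp hk hL) ?_ (by positivity)) (Real.exp_pos _).le
        exact Finset.sum_nonneg fun y _ => mul_nonneg (prefixProd_prefixType_pos y k).le
          (Finset.prod_nonneg fun _ _ => hp.1 _)

/-- If `r` explains a sequence nearly as well as its type, the sequence is unlikely under every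
distribution that overlaps little with `r`. -/
lemma prefixProd_le_of_prefixProd_prefixType_le {q r : X → ℝ} (hq : q ∈ stdSimplex ℝ X)
    (hr : ∀ a, 0 < r a) {η γ β : ℝ} (h0 : 0 < η) (h1 : η < 1)
    (hG : ∑ a, r a ^ η * q a ^ (1 - η) ≤ Real.exp (-γ * η - β * (1 - η)))
    {z : Fin N → X} (hN : 1 ≤ N)
    (hz : prefixProd (prefixType z N) z N ≤ Real.exp (γ * N) * prefixProd r z N) :
    prefixProd q z N ≤ prefixProd (prefixType z N) z N * Real.exp (-β * N) := by
  set G := ∑ a, r a ^ η * q a ^ (1 - η) with hGdef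
  set A := prefixProd (prefixType z N) z N with hA
  have hA0 : 0 < A := prefixProd_prefixType_pos z N
  have h1' : 0 < 1 - η := by linarith
  have hterm : ∀ a, 0 ≤ r a ^ η * q a ^ (1 - η) := fun a =>
    mul_nonneg (Real.rpow_nonneg (hr a).le _) (Real.rpow_nonneg (hq.1 a) _)
  have hGpos : 0 < G := by
    obtain ⟨a, -, ha⟩ : ∃ a ∈ Finset.univ, 0 < q a := Finset.exists_lt_of_sum_lt (by
      rw [hq.2, Finset.sum_const_zero]; exact one_pos)
    exact Finset.sum_pos' (fun a _ => hterm a) ⟨a, Finset.mem_univ a,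
      mul_pos (Real.rpow_pos_of_pos (hr a) _) (Real.rpow_pos_of_pos ha _)⟩
  -- Maximality of the type against the normalised tilt gives `R ^ η * W ^ (1 - η) ≤ A * G ^ N`.
  -- With `A ≤ exp (γ N) * R`, the factor `A ^ η` cancels and a root of order `1 - η` remains.
  have hML := prefixProd_le_prefixType z hN le_rfl (r := fun a => r a ^ η * q a ^ (1 - η) / G)
    (fun a => div_nonneg (hterm a) hGpos.le) (by rw [← Finset.sum_div, div_self hGpos.ne'])
  rw [prefixProd_self, Finset.prod_div_distrib, Finset.prod_mul_distrib,
    Real.finsetProd_rpow _ _ (fun t _ => (hr _).le), Real.finsetProd_rpow _ _ (fun t _ => hq.1 _),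
    Finset.prod_const, Finset.card_univ, Fintype.card_fin, ← prefixProd_self, ← prefixProd_self,
    div_le_iff₀ (by positivity), ← hA] at hML
  set R := prefixProd r z N with hR
  set W := prefixProd q z N with hW
  have hW0 : 0 ≤ W := prefixProd_nonneg hq.1 _ _
  have hR0 : 0 < R := Finset.prod_pos fun _ _ => hr _
  have h2 : A ^ η ≤ Real.exp (γ * N * η) * R ^ η := by
    rw [Real.exp_mul, ← Real.mul_rpow (Real.exp_pos _).le hR0.le]
    exact Real.rpow_le_rpow hA0.le hz h0.le
  have h3 : G ^ N ≤ Real.exp ((-γ * η - β * (1 - η)) * N) := by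
    rw [mul_comm, Real.exp_nat_mul]
    exact pow_le_pow_left₀ hGpos.le hG N
  have h4 : A ^ η * W ^ (1 - η) ≤ A ^ η * (A * Real.exp (-β * N)) ^ (1 - η) := by
    have hWp : 0 ≤ W ^ (1 - η) := Real.rpow_nonneg hW0 _
    calc A ^ η * W ^ (1 - η) ≤ Real.exp (γ * N * η) * R ^ η * W ^ (1 - η) :=
          mul_le_mul_of_nonneg_right h2 hWp
      _ = Real.exp (γ * N * η) * (R ^ η * W ^ (1 - η)) := by ring
      _ ≤ Real.exp (γ * N * η) * (A * Real.exp ((-γ * η - β * (1 - η)) * N)) :=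
          mul_le_mul_of_nonneg_left (hML.trans (mul_le_mul_of_nonneg_left h3 hA0.le))
            (Real.exp_pos _).le
      _ = A ^ (η + (1 - η)) * Real.exp (-β * N * (1 - η)) := by
          rw [add_sub_cancel, Real.rpow_one, mul_left_comm, ← Real.exp_add]
          ring_nf
      _ = _ := by
          rw [Real.rpow_add hA0, Real.mul_rpow hA0.le (Real.exp_pos _).le, ← Real.exp_mul]
          ring
  exact (Real.rpow_le_rpow_iff hW0 (by positivity) h1').1
    (le_of_mul_le_mul_left h4 (Real.rpow_pos_of_pos hA0 _))

lemma pairMix_le (z : Fin N → X) (y : Fin (N ^ 2) → X) {p : X → ℝ} (hp : ∀ a, 0 ≤ p a) {ε : ℝ}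
    (hε : 0 < ε) (hN : 1 ≤ N) (hNε : 1 ≤ ε * N)
    (hy : ∀ a, prefixType y (N ^ 2) a ≤ p a + ε) (a : X) :
    pairMix z y (N ^ 2) a ≤ p a + 2 * ε := by
  have hN0 : (0 : ℝ) < N := by exact_mod_cast hN
  have hle : prefixType z N a ≤ 1 := by
    rw [← sum_prefixType z hN le_rfl]
    exact Finset.single_le_sum (fun a _ => prefixType_nonneg z N a) (Finset.mem_univ a)
  -- Against `N²` test samples the training type enters the mixture with relative weight only `1 /
  -- N`.
  have h1 : ((N : ℝ) / ((N ^ 2 : ℕ) : ℝ)) = 1 / N := by push_cast; field_simp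
  have h2 : 1 / (N : ℝ) ≤ ε := by rw [div_le_iff₀ hN0]; exact hNε
  have h3 : (0 : ℝ) < 1 / N := by positivity
  have h4 := hp a
  have h5 := prefixType_nonneg z N a
  simp only [pairMix, mix]
  rw [h1, div_le_iff₀ (by positivity)]
  nlinarith [hy a]

/-- The `ρ` terms cover test types exceeding `p + ε` somewhere. Otherwise `p + 2 ε` dominates the
pooled type; it is positive everywhere, and the tilting bound does not need it normalised. -/
lemma pairProb_pairScore_lt_le {p q : X → ℝ} (hp : p ∈ stdSimplex ℝ X) (hq : q ∈ stdSimplex ℝ X)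
    {η γ β ε : ℝ} (h0 : 0 < η) (h1 : η < 1) (hε : 0 < ε)
    (hG : ∑ a, (p a + 2 * ε) ^ η * q a ^ (1 - η) ≤ Real.exp (-γ * η - β * (1 - η))) :
    ∃ ρ : X → ℝ, (∀ a, 0 ≤ ρ a) ∧ (∀ a, ρ a < 1) ∧ ∀ N : ℕ, 1 ≤ N → 1 ≤ ε * N →
      pairProb q p (fun (z : Fin N → X) (y : Fin (N ^ 2) → X) => pairScore z y (N ^ 2) < γ * N)
        ≤ ∑ a, ρ a ^ N ^ 2 + ((N : ℝ) + 1) ^ Fintype.card X * Real.exp (-β * N) := by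
  classical
  choose ρ hρ0 hρ1 hρ using fun a => exists_sum_prefixType_le_pow hp a hε
  refine ⟨ρ, hρ0, hρ1, fun N hN hNε => ?_⟩
  have hL : 1 ≤ N ^ 2 := Nat.one_le_pow _ _ hN
  have hq0 : ∀ z : Fin N → X, 0 ≤ ∏ t, q (z t) := fun z => Finset.prod_nonneg fun _ _ => hq.1 _
  have hp0 : ∀ y : Fin (N ^ 2) → X, 0 ≤ ∏ t, p (y t) :=
    fun y => Finset.prod_nonneg fun _ _ => hp.1 _
  calc pairProb q p (fun (z : Fin N → X) (y : Fin (N ^ 2) → X) => pairScore z y (N ^ 2) < γ * N)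
      ≤ ∑ z : Fin N → X, ∑ y : Fin (N ^ 2) → X,
        (∑ a, (∏ t, q (z t)) *
            (if p a + ε < prefixType y (N ^ 2) a then ∏ t, p (y t) else 0)
          + prefixProd (prefixType z N) z N * Real.exp (-β * N) * ∏ t, p (y t)) := by
        refine Finset.sum_le_sum fun z _ => Finset.sum_le_sum fun y _ => ?_
        have hs : ∀ a, 0 ≤ (∏ t, q (z t)) *
            (if p a + ε < prefixType y (N ^ 2) a then ∏ t, p (y t) else 0) := fun a =>
          mul_nonneg (hq0 z) (by split_ifs <;> simp [hp0 y])
        have hs' := Finset.sum_nonneg fun a (_ : a ∈ Finset.univ) => hs a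
        have hA := prefixProd_prefixType_pos z N
        have hB := hp0 y
        have hC : 0 ≤ prefixProd (prefixType z N) z N * Real.exp (-β * N) * ∏ t, p (y t) := by
          positivity
        split_ifs with h
        · by_cases hy : ∃ a, p a + ε < prefixType y (N ^ 2) a
          · obtain ⟨a, ha⟩ := hy
            have := Finset.single_le_sum (fun a _ => hs a) (Finset.mem_univ a)
            rw [if_pos ha] at this
            linarith
          · push Not at hy
            have h2 := prefixProd_le_of_pairScore_lt hN hL le_rfl h
            have h3 := h2.trans (mul_le_mul_of_nonneg_left
              (prefixProd_mono (pairMix_nonneg z y _) (pairMix_le z y hp.1 hε hN hNε hy) z N)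
              (Real.exp_pos _).le)
            have h4 := prefixProd_le_of_prefixProd_prefixType_le hq
              (fun a => by have := hp.1 a; positivity) h0 h1 hG hN h3
            rw [prefixProd_self q] at h4
            exact (mul_le_mul_of_nonneg_right h4 hB).trans (le_add_of_nonneg_left hs')
        · linarith
    _ = ∑ a, ∑ y : Fin (N ^ 2) → X,
          (if p a + ε < prefixType y (N ^ 2) a then ∏ t, p (y t) else 0)
        + (∑ z : Fin N → X, prefixProd (prefixType z N) z N) * Real.exp (-β * N) := by
        simp_rw [Finset.sum_add_distrib, ← Finset.mul_sum, sum_prod_eq_one hp, mul_one,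
          ← Finset.sum_mul]
        rw [sum_prod_eq_one hq, one_mul, Finset.sum_comm]
    _ ≤ _ := add_le_add (Finset.sum_le_sum fun a _ => hρ a _ hL)
        (mul_le_mul_of_nonneg_right (sum_prod_prefixType_le hp hN) (Real.exp_pos _).le)

lemma add_one_pow_le_two_mul_pow {n : ℕ} (hn : 1 ≤ n) (c : ℕ) :
    ((n : ℝ) + 1) ^ c ≤ 2 ^ c * (n : ℝ) ^ c := by
  have : (1 : ℝ) ≤ n := by exact_mod_cast hn
  rw [← mul_pow]
  exact pow_le_pow_left₀ (by positivity) (by linarith) c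

lemma decays_pairProb_le_pairScore {p : X → ℝ} (hp : p ∈ stdSimplex ℝ X) (γ : ℝ) :
    Decays (fun N => ∑ k ∈ Finset.Icc 1 (N ^ 2), pairProb p p
        (fun (z : Fin N → X) (y : Fin (N ^ 2) → X) => γ * N ≤ pairScore z y k)) γ := by
  set c := Fintype.card X
  -- The degree collects `N²` times, the factor `N ^ c` for training and `(N²) ^ c` for test types.
  refine ((decays_exp γ).mul_pow (K := 2 ^ c * 2 ^ c) (by positivity) (2 + (c + 2 * c))).mono ?_
  filter_upwards [eventually_ge_atTop 1] with N hN
  have hL : 1 ≤ N ^ 2 := Nat.one_le_pow _ _ hN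
  calc ∑ k ∈ Finset.Icc 1 (N ^ 2), pairProb p p
        (fun (z : Fin N → X) (y : Fin (N ^ 2) → X) => γ * N ≤ pairScore z y k)
      ≤ ∑ k ∈ Finset.Icc 1 (N ^ 2), Real.exp (-(γ * N)) *
        ((2 ^ c * (N : ℝ) ^ c) * (2 ^ c * (((N ^ 2 : ℕ) : ℝ)) ^ c)) := by
        refine Finset.sum_le_sum fun k hk => ?_
        rw [Finset.mem_Icc] at hk
        refine (pairProb_le_pairScore_le hp _ hN hk.1 hk.2).trans ?_
        refine mul_le_mul_of_nonneg_left (mul_le_mul (add_one_pow_le_two_mul_pow hN c)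
          (le_trans ?_ (add_one_pow_le_two_mul_pow hL c)) (by positivity) (by positivity))
          (Real.exp_pos _).le
        refine pow_le_pow_left₀ (by positivity) ?_ c
        have := (Nat.cast_le (α := ℝ)).2 hk.2
        linarith
    _ = _ := by
        rw [Finset.sum_const, Nat.card_Icc, nsmul_eq_mul, neg_mul]
        simp only [add_tsub_cancel_right]
        push_cast
        ring

lemma decays_pairProb_pairScore_lt {p q : X → ℝ} (hp : p ∈ stdSimplex ℝ X)
    (hq : q ∈ stdSimplex ℝ X) {η γ : ℝ} (h0 : 0 < η) (h1 : η < 1)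
    (hG : ∑ a, p a ^ η * q a ^ (1 - η) ≤ Real.exp (-γ)) :
    Decays (fun N => pairProb q p (fun (z : Fin N → X) (y : Fin (N ^ 2) → X) =>
      pairScore z y (N ^ 2) < γ * N)) γ := by
  refine Decays.of_forall_sub fun δ hδ => ?_
  -- The exponent on the right is `-γ + δ (1 - η)`; as `η < 1`, this leaves room to replace `0` by a
  -- small `ε`.
  have hlt : ∑ a, (p a + 2 * 0) ^ η * q a ^ (1 - η)
      < Real.exp (-γ * η - (γ - δ) * (1 - η)) := by
    simp only [mul_zero, add_zero]
    refine hG.trans_lt (Real.exp_lt_exp.2 ?_)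
    nlinarith
  have hcont : Continuous fun ε : ℝ => ∑ a, (p a + 2 * ε) ^ η * q a ^ (1 - η) :=
    continuous_finsetSum _ fun a _ => Continuous.mul
      (Continuous.rpow_const (by fun_prop) fun _ => Or.inr h0.le) continuous_const
  obtain ⟨ε, hε, hε0⟩ := (((hcont.tendsto 0).eventually (eventually_lt_nhds hlt)).filter_mono
    nhdsWithin_le_nhds |>.and (self_mem_nhdsWithin (s := Set.Ioi (0 : ℝ)))).exists
  have hε0 : 0 < ε := hε0
  obtain ⟨ρ, hρ0, hρ1, hρ⟩ := pairProb_pairScore_lt_le hp hq h0 h1 hε0 hε.le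
  set c := Fintype.card X
  refine ((Decays.sum Finset.univ fun a _ => decays_pow_sq (hρ0 a) (hρ1 a) (γ - δ)).add
    ((decays_exp (γ - δ)).mul_pow (K := 2 ^ c) (by positivity) c)).mono ?_
  filter_upwards [eventually_ge_atTop 1,
    (tendsto_natCast_atTop_atTop (R := ℝ)).eventually (eventually_ge_atTop (1 / ε))] with N hN hN2
  rw [div_le_iff₀ hε0, mul_comm] at hN2
  refine (hρ N hN hN2).trans (add_le_add le_rfl ?_)
  exact mul_le_mul_of_nonneg_right (add_one_pow_le_two_mul_pow hN c) (Real.exp_pos _).le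

variable {M : ℕ} {P : Fin M → X → ℝ} {prior : Fin M → ℝ}

lemma le_bayesianExponent (hP : ∀ i, P i ∈ stdSimplex ℝ X) (hprior : ∀ i, 0 < prior i) {γ : ℝ}
    (h : ∀ i j, i ≠ j → ∃ η : ℝ, 0 < η ∧ η < 1 ∧
      ∑ a, P i a ^ η * P j a ^ (1 - η) ≤ Real.exp (-γ)) :
    (γ : EReal) ≤ bayesianExponent P prior γ := by
  refine Decays.le_liminf (Decays.sum Finset.univ fun i _ => Decays.const_mul ?_ (hprior i).le)
  refine ((decays_pairProb_le_pairScore (hP i) γ).add (Decays.sum (Finset.univ.erase i)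
    fun j hj => ?_)).mono ((eventually_ge_atTop 1).mono fun N hN => errProb_le hP γ hN i)
  obtain ⟨η, h0, h1, hG⟩ := h i j (Finset.ne_of_mem_erase hj).symm
  exact decays_pairProb_pairScore_lt (hP i) (hP j) h0 h1 hG

lemma bayesianExponent_nonneg (hP : ∀ i, P i ∈ stdSimplex ℝ X) (hprior : ∀ i, 0 < prior i)
    (hsum : ∑ i, prior i = 1) (γ : ℝ) : 0 ≤ bayesianExponent P prior γ := by
  refine Decays.le_liminf (γ := 0) ((decays_exp 0).mono (.of_forall fun N => ?_))
  simp only [neg_zero, zero_mul, Real.exp_zero]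
  rw [bayesErr, ← hsum]
  exact Finset.sum_le_sum fun i _ => mul_le_of_le_one_right (hprior i).le (errProb_le_one hP γ i)

end Achievability

/-! ### Converse by change of measure. -/

section Converse

variable {X : Type*} {N L : ℕ}

/-- A bound on the log-likelihood ratio of a sequence as a bound on likelihoods. -/
lemma prod_le_exp_mul_prod {Q p : X → ℝ} (hp : ∀ a, 0 ≤ p a)
    (hQp : ∀ a, p a = 0 → Q a = 0) {z : Fin N → X} (hz : ∀ t, 0 < Q (z t)) {D : ℝ}
    (h : ∑ t, Real.log (Q (z t) / p (z t)) ≤ D * N) :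
    ∏ t, Q (z t) ≤ Real.exp (D * N) * ∏ t, p (z t) := by
  have hpz : ∀ t, 0 < p (z t) := fun t =>
    (hp _).lt_of_ne fun e => (hz t).ne' (hQp _ e.symm)
  calc ∏ t, Q (z t) = Real.exp (∑ t, Real.log (Q (z t) / p (z t))) * ∏ t, p (z t) := by
        rw [Real.exp_sum, ← Finset.prod_mul_distrib]
        refine Finset.prod_congr rfl fun t _ => ?_
        rw [Real.exp_log (div_pos (hz t) (hpz t)), div_mul_cancel₀ _ (hpz t).ne']
    _ ≤ _ := mul_le_mul_of_nonneg_right (Real.exp_le_exp.2 h)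
        (Finset.prod_nonneg fun _ _ => hp _)

variable [Fintype X]

open Classical in
/-- Prefixes whose type is much likelier than their law are rare. -/
lemma sum_indicator_prefixProd_le {p : X → ℝ} (hp : p ∈ stdSimplex ℝ X) {k : ℕ} (s : ℝ)
    (hk : 1 ≤ k) (hL : k ≤ L) :
    ∑ y : Fin L → X, (if Real.exp s * prefixProd p y k ≤ prefixProd (prefixType y k) y k
      then ∏ t, p (y t) else 0) ≤ Real.exp (-s) * ((k : ℝ) + 1) ^ Fintype.card X := by
  refine le_trans ?_ (mul_le_mul_of_nonneg_left (sum_prefixProd_prefixType_le hp hk hL)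
    (Real.exp_pos (-s)).le)
  rw [Finset.mul_sum]
  refine Finset.sum_le_sum fun y _ => ?_
  have h0 : 0 ≤ ∏ t : Fin L with ¬ t.val < k, p (y t) :=
    Finset.prod_nonneg fun _ _ => hp.1 _
  split_ifs with h
  · rw [← prefixProd_mul_compl p y k, ← mul_assoc]
    refine mul_le_mul_of_nonneg_right ?_ h0
    calc prefixProd p y k = Real.exp (-s) * (Real.exp s * prefixProd p y k) := by
          rw [← mul_assoc, ← Real.exp_add]; simp
      _ ≤ _ := mul_le_mul_of_nonneg_left h (Real.exp_pos _).le
  · exact mul_nonneg (Real.exp_pos _).le (mul_nonneg (prefixProd_prefixType_pos y k).le h0)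

lemma tendsto_exp_neg_mul_pow (K : ℝ) (d : ℕ) {δ : ℝ} (hδ : 0 < δ) :
    Tendsto (fun N : ℕ => Real.exp (-(δ * N)) * (K * (N : ℝ) ^ d)) atTop (𝓝 0) := by
  have h := ((isLittleO_pow_exp_pos_mul_atTop d hδ).comp_tendsto
    (tendsto_natCast_atTop_atTop (R := ℝ))).tendsto_div_nhds_zero.const_mul K
  simp only [mul_zero] at h
  refine h.congr fun N => ?_
  simp only [Function.comp_apply, Real.exp_neg]
  field_simp

-- The `N²` prefixes cost a polynomial factor in the union bound, which the slack `exp (δ N)`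
-- absorbs.
open Classical in
lemma eventually_half_le_sum_test {p : X → ℝ} (hp : p ∈ stdSimplex ℝ X) {δ : ℝ} (hδ : 0 < δ) :
    ∀ᶠ N : ℕ in atTop, 1 / 2 ≤ ∑ y : Fin (N ^ 2) → X,
      if ∀ k, 1 ≤ k → k ≤ N ^ 2 → prefixProd (prefixType y k) y k
        < Real.exp (δ * N) * prefixProd p y k then ∏ t, p (y t) else 0 := by
  set c := Fintype.card X
  filter_upwards [(tendsto_exp_neg_mul_pow (2 ^ c) (2 + 2 * c) hδ).eventually
    (eventually_le_nhds (one_half_pos)), eventually_ge_atTop 1] with N h hN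
  have hL : 1 ≤ N ^ 2 := Nat.one_le_pow _ _ hN
  have key : ∑ y : Fin (N ^ 2) → X, ∏ t, p (y t) ≤ ∑ y : Fin (N ^ 2) → X,
      ((if ∀ k, 1 ≤ k → k ≤ N ^ 2 → prefixProd (prefixType y k) y k
        < Real.exp (δ * N) * prefixProd p y k then ∏ t, p (y t) else 0)
      + ∑ k ∈ Finset.Icc 1 (N ^ 2), if Real.exp (δ * N) * prefixProd p y k
        ≤ prefixProd (prefixType y k) y k then ∏ t, p (y t) else 0) := by
    refine Finset.sum_le_sum fun y _ => ?_
    have h0 : 0 ≤ ∏ t, p (y t) := Finset.prod_nonneg fun _ _ => hp.1 _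
    have hs : ∀ k, 0 ≤ (if Real.exp (δ * N) * prefixProd p y k
        ≤ prefixProd (prefixType y k) y k then ∏ t, p (y t) else 0) := fun k => by
      split_ifs <;> simp [h0]
    split_ifs with h1
    · exact le_add_of_nonneg_right (Finset.sum_nonneg fun k _ => hs k)
    · push Not at h1
      obtain ⟨k, hk1, hk2, hk3⟩ := h1
      have := Finset.single_le_sum (fun k _ => hs k) (Finset.mem_Icc.2 ⟨hk1, hk2⟩)
      rw [if_pos hk3] at this
      linarith
  rw [sum_prod_eq_one hp, Finset.sum_add_distrib, Finset.sum_comm (t := Finset.Icc 1 (N ^ 2))]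
    at key
  have hbad : ∑ k ∈ Finset.Icc 1 (N ^ 2), ∑ y : Fin (N ^ 2) → X,
      (if Real.exp (δ * N) * prefixProd p y k
        ≤ prefixProd (prefixType y k) y k then ∏ t, p (y t) else 0)
      ≤ Real.exp (-(δ * N)) * (2 ^ c * (N : ℝ) ^ (2 + 2 * c)) := by
    calc _ ≤ ∑ k ∈ Finset.Icc 1 (N ^ 2),
          Real.exp (-(δ * N)) * (2 ^ c * (((N ^ 2 : ℕ) : ℝ)) ^ c) := by
          refine Finset.sum_le_sum fun k hk => ?_
          rw [Finset.mem_Icc] at hk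
          refine (sum_indicator_prefixProd_le hp _ hk.1 hk.2).trans
            (mul_le_mul_of_nonneg_left (le_trans ?_ (add_one_pow_le_two_mul_pow hL c))
            (Real.exp_pos _).le)
          refine pow_le_pow_left₀ (by positivity) ?_ c
          have := (Nat.cast_le (α := ℝ)).2 hk.2
          linarith
      _ = _ := by
          rw [Finset.sum_const, Nat.card_Icc, nsmul_eq_mul]
          simp only [add_tsub_cancel_right]
          push_cast
          ring
  linarith

/-- Training sequences that look as if drawn from `Q`. -/
def IsTypicalFor (Q p q : X → ℝ) (δ : ℝ) (z : Fin N → X) : Prop :=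
  prefixProd (prefixType z N) z N < Real.exp (δ * N) * ∏ t, Q (z t) ∧
    ∏ t, Q (z t) ≤ Real.exp ((kl Q p + δ) * N) * ∏ t, p (z t) ∧
    ∏ t, Q (z t) ≤ Real.exp ((kl Q q + δ) * N) * ∏ t, q (z t)

open Classical in
lemma eventually_half_le_sum_training {Q p q : X → ℝ} (hQ : Q ∈ stdSimplex ℝ X)
    (hp : ∀ a, 0 ≤ p a) (hq : ∀ a, 0 ≤ q a) (hQp : ∀ a, p a = 0 → Q a = 0)
    (hQq : ∀ a, q a = 0 → Q a = 0) {δ : ℝ} (hδ : 0 < δ) :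
    ∀ᶠ N : ℕ in atTop, 1 / 2 ≤ ∑ z : Fin N → X,
      if IsTypicalFor Q p q δ z then ∏ t, Q (z t) else 0 := by
  set c := Fintype.card X
  obtain ⟨ρ₁, h01, h11, hρ1⟩ := exists_sum_indicator_le_pow hQ (fun a => Real.log (Q a / p a))
    (c := kl Q p + δ) (by rw [kl]; linarith)
  obtain ⟨ρ₂, h02, h12, hρ2⟩ := exists_sum_indicator_le_pow hQ (fun a => Real.log (Q a / q a))
    (c := kl Q q + δ) (by rw [kl]; linarith)
  have hlim := ((tendsto_exp_neg_mul_pow (2 ^ c) c hδ).add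
    (tendsto_pow_atTop_nhds_zero_of_lt_one h01 h11)).add
    (tendsto_pow_atTop_nhds_zero_of_lt_one h02 h12)
  simp only [add_zero] at hlim
  filter_upwards [hlim.eventually (eventually_le_nhds (one_half_pos)), eventually_ge_atTop 1]
    with N h hN
  have key : ∑ z : Fin N → X, ∏ t, Q (z t) ≤ ∑ z : Fin N → X,
      ((if IsTypicalFor Q p q δ z then ∏ t, Q (z t) else 0)
      + (if Real.exp (δ * N) * prefixProd Q z N ≤ prefixProd (prefixType z N) z N
          then ∏ t, Q (z t) else 0)
      + (if (kl Q p + δ) * N ≤ ∑ t, Real.log (Q (z t) / p (z t)) then ∏ t, Q (z t) else 0)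
      + (if (kl Q q + δ) * N ≤ ∑ t, Real.log (Q (z t) / q (z t)) then ∏ t, Q (z t) else 0)) := by
    refine Finset.sum_le_sum fun z _ => ?_
    have h0 : 0 ≤ ∏ t, Q (z t) := Finset.prod_nonneg fun _ _ => hQ.1 _
    -- Sequences of zero weight are discarded, so that every logarithm below has a positive
    -- argument.
    rcases h0.eq_or_lt with h0 | h0
    · simp [← h0]
    · have hz : ∀ t, 0 < Q (z t) := fun t => (hQ.1 _).lt_of_ne fun e =>
        h0.ne' (Finset.prod_eq_zero (Finset.mem_univ t) e.symm)
      by_cases h1 : Real.exp (δ * N) * prefixProd Q z N ≤ prefixProd (prefixType z N) z N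
      · rw [if_pos h1]; split_ifs <;> linarith
      by_cases h2 : (kl Q p + δ) * N ≤ ∑ t, Real.log (Q (z t) / p (z t))
      · rw [if_pos h2]; split_ifs <;> linarith
      by_cases h3 : (kl Q q + δ) * N ≤ ∑ t, Real.log (Q (z t) / q (z t))
      · rw [if_pos h3]; split_ifs <;> linarith
      have h4 : IsTypicalFor Q p q δ z := by
        refine ⟨?_, prod_le_exp_mul_prod hp hQp hz (not_le.1 h2).le,
          prod_le_exp_mul_prod hq hQq hz (not_le.1 h3).le⟩
        rw [← prefixProd_self]
        exact not_le.1 h1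
      rw [if_pos h4]; split_ifs; linarith
  rw [sum_prod_eq_one hQ, Finset.sum_add_distrib, Finset.sum_add_distrib,
    Finset.sum_add_distrib] at key
  have hb := (sum_indicator_prefixProd_le hQ (L := N) (δ * N) hN le_rfl).trans
    (mul_le_mul_of_nonneg_left (add_one_pow_le_two_mul_pow hN c) (Real.exp_pos _).le)
  linarith [hρ1 N, hρ2 N]

/-- By maximality of the pooled type, comparing with `p` bounds the score from above. Each
comparison costs one `δ`: the training type with `Q`, `Q` with `p`, the test type with `p`. -/
lemma pairScore_lt_of_isTypicalFor {Q p q : X → ℝ} (hp : p ∈ stdSimplex ℝ X)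
    {δ γ : ℝ} (hγ : kl Q p + 3 * δ ≤ γ) (hN : 1 ≤ N) {z : Fin N → X} {y : Fin L → X}
    (hz : IsTypicalFor Q p q δ z) {k : ℕ} (hk : 1 ≤ k) (hL : k ≤ L)
    (hy : prefixProd (prefixType y k) y k < Real.exp (δ * N) * prefixProd p y k) :
    pairScore z y k < γ * N := by
  refine pairScore_lt_of_prefixProd_lt hp hN hk hL ?_
  have h1 := hz.1
  have h2 := hz.2.1
  rw [← prefixProd_self p] at h2
  have hpz := prefixProd_nonneg hp.1 z N
  have hpy := prefixProd_nonneg hp.1 y k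
  calc prefixProd (prefixType z N) z N * prefixProd (prefixType y k) y k
      < (Real.exp (δ * N) * ∏ t, Q (z t)) * (Real.exp (δ * N) * prefixProd p y k) :=
        mul_lt_mul'' h1 hy (prefixProd_prefixType_pos _ _).le (prefixProd_prefixType_pos _ _).le
    _ ≤ (Real.exp (δ * N) * (Real.exp ((kl Q p + δ) * N) * prefixProd p z N))
        * (Real.exp (δ * N) * prefixProd p y k) := by gcongr
    _ = Real.exp ((kl Q p + 3 * δ) * N) * (prefixProd p z N * prefixProd p y k) := by
        rw [show (kl Q p + 3 * δ) * (N : ℝ) = δ * N + (kl Q p + δ) * N + δ * N by ring,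
          Real.exp_add, Real.exp_add]
        ring
    _ ≤ _ := by gcongr

variable {M : ℕ} {P : Fin M → X → ℝ} {prior : Fin M → ℝ}

/-- Converse: a training sequence of class `j` may look as if drawn from `Q`, and then its score
stays below the threshold under hypothesis `i`. -/
lemma bayesianExponent_le_kl (hP : ∀ i, P i ∈ stdSimplex ℝ X) (hprior : ∀ i, 0 < prior i)
    {i j : Fin M} (hij : i ≠ j) {Q : X → ℝ} (hQ : Q ∈ stdSimplex ℝ X)
    (hQi : ∀ a, P i a = 0 → Q a = 0) (hQj : ∀ a, P j a = 0 → Q a = 0) {γ : ℝ}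
    (hγ : kl Q (P i) < γ) : bayesianExponent P prior γ ≤ (kl Q (P j) : EReal) := by
  classical
  refine liminf_le_of_eventually_exp_le fun δ' hδ' => ?_
  -- Three `δ` must fit below the threshold, and `δ ≤ δ' / 2` leaves `exp (-δ' N / 2)` to absorb the
  -- prior and the factor `1 / 4`.
  obtain ⟨δ, hδ, hδ1, hδ2⟩ : ∃ δ : ℝ, 0 < δ ∧ kl Q (P i) + 3 * δ ≤ γ ∧ δ ≤ δ' / 2 :=
    ⟨min ((γ - kl Q (P i)) / 3) (δ' / 2), lt_min (by linarith) (by linarith),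
      by linarith [min_le_left ((γ - kl Q (P i)) / 3) (δ' / 2)], min_le_right _ _⟩
  filter_upwards [eventually_half_le_sum_test (hP i) hδ,
    eventually_half_le_sum_training hQ (hP i).1 (hP j).1 hQi hQj hδ, eventually_ge_atTop 1,
    eventually_mul_pow_le_exp (4 / prior i) 0 (half_pos hδ')] with N hB hA hN hK
  rw [pow_zero, mul_one] at hK
  have h1 : Real.exp (-((kl Q (P j) + δ) * N)) * (1 / 2 * (1 / 2)) ≤ errProb P γ N i := by
    refine le_trans ?_ (pairProb_le_errProb hP γ hij)
    refine (mul_le_mul_of_nonneg_left (mul_le_mul hA hB (by norm_num) (by linarith))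
      (Real.exp_pos _).le).trans ?_
    rw [Finset.sum_mul_sum, Finset.mul_sum]
    refine Finset.sum_le_sum fun z _ => ?_
    rw [Finset.mul_sum]
    refine Finset.sum_le_sum fun y _ => ?_
    have hz0 : 0 ≤ ∏ t, P j (z t) := Finset.prod_nonneg fun _ _ => (hP j).1 _
    have hy0 : 0 ≤ ∏ t, P i (y t) := Finset.prod_nonneg fun _ _ => (hP i).1 _
    by_cases hz : IsTypicalFor Q (P i) (P j) δ z
    · by_cases hy : ∀ k, 1 ≤ k → k ≤ N ^ 2 → prefixProd (prefixType y k) y k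
        < Real.exp (δ * N) * prefixProd (P i) y k
      · rw [if_pos hz, if_pos hy, if_pos fun k hk hk' =>
          pairScore_lt_of_isTypicalFor (hP i) hδ1 hN hz hk hk' (hy k hk hk'), ← mul_assoc]
        refine mul_le_mul_of_nonneg_right ?_ hy0
        rw [Real.exp_neg, inv_mul_le_iff₀ (Real.exp_pos _)]
        exact hz.2.2
      · rw [if_neg hy, mul_zero, mul_zero]
        split_ifs <;> positivity
    · rw [if_neg hz, zero_mul, mul_zero]
      split_ifs <;> positivity
  have h2 : prior i * errProb P γ N i ≤ bayesErr P prior γ N :=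
    Finset.single_le_sum (f := fun l => prior l * errProb P γ N l)
      (fun l _ => mul_nonneg (hprior l).le (errProb_nonneg hP γ l)) (Finset.mem_univ i)
  refine le_trans ?_ h2
  refine le_trans ?_ (mul_le_mul_of_nonneg_left h1 (hprior i).le)
  have hN0 : (0 : ℝ) ≤ N := by positivity
  calc Real.exp (-(kl Q (P j) + δ') * N)
      ≤ Real.exp (-((kl Q (P j) + δ) * N) - δ' / 2 * N) := Real.exp_le_exp.2 (by nlinarith)
    _ = Real.exp (-((kl Q (P j) + δ) * N)) * (Real.exp (δ' / 2 * N))⁻¹ := by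
        rw [sub_eq_add_neg, Real.exp_add, Real.exp_neg (δ' / 2 * N)]
    _ ≤ Real.exp (-((kl Q (P j) + δ) * N)) * (prior i * (1 / 2 * (1 / 2))) := by
        refine mul_le_mul_of_nonneg_left ?_ (Real.exp_pos _).le
        rw [inv_le_comm₀ (Real.exp_pos _) (by have := hprior i; positivity)]
        refine le_trans (le_of_eq ?_) hK
        have := (hprior i).ne'
        field_simp
        norm_num
    _ = _ := by ring

end Converse

/-! ### Chernoff information and tilted distributions. -/

section ChernoffInformation

variable {X : Type*} {p q : X → ℝ}

open Classical in
/-- The restriction of `q` to the common support of `p` and `q`. -/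
noncomputable def commonPart (p q : X → ℝ) : X → ℝ := fun a => if p a = 0 ∨ q a = 0 then 0 else q a

/-- The unnormalised tilted weights between `q` and `p`. -/
noncomputable def tilt (p q : X → ℝ) (s : ℝ) : X → ℝ := fun a =>
  commonPart p q a * Real.exp (s * Real.log (p a / q a))

lemma rpow_mul_rpow_eq_tilt (hp : ∀ a, 0 ≤ p a) (hq : ∀ a, 0 ≤ q a) {s : ℝ}
    {a : X} (h : p a = 0 ∨ q a = 0 → p a ^ s * q a ^ (1 - s) = 0) :
    p a ^ s * q a ^ (1 - s) = tilt p q s a := by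
  unfold tilt commonPart
  split_ifs with h1
  · rw [h h1, zero_mul]
  · push Not at h1
    have hp' := (hp a).lt_of_ne h1.1.symm
    have hq' := (hq a).lt_of_ne h1.2.symm
    rw [Real.log_div hp'.ne' hq'.ne', Real.rpow_def_of_pos hp', Real.rpow_def_of_pos hq',
      ← Real.exp_add]
    nth_rw 2 [← Real.exp_log hq']
    rw [← Real.exp_add]
    ring_nf

variable [Fintype X]

lemma chernoff_nonneg (hq : q ∈ stdSimplex ℝ X) : 0 ≤ chernoff p q := by
  rw [chernoff, EReal.le_neg, neg_zero]
  refine (iInf₂_le (0 : ℝ) ⟨le_rfl, zero_le_one⟩).trans ?_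
  simp [hq.2]

/-- At `η = 0` and `η = 1` the affinity is one, which is not below `exp (-γ)`, so the parameter is
interior. -/
lemma exists_affinity_le_of_lt_chernoff (hp : p ∈ stdSimplex ℝ X) (hq : q ∈ stdSimplex ℝ X)
    {γ : ℝ} (h0 : 0 ≤ γ) (h : (γ : EReal) < chernoff p q) :
    ∃ η : ℝ, 0 < η ∧ η < 1 ∧ ∑ a, p a ^ η * q a ^ (1 - η) ≤ Real.exp (-γ) := by
  rw [chernoff, EReal.lt_neg_comm, iInf_lt_iff] at h
  obtain ⟨η, h⟩ := h
  obtain ⟨hη, h⟩ := iInf_lt_iff.1 h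
  have h2 : ∑ a, p a ^ η * q a ^ (1 - η) < Real.exp (-γ) := by
    rw [← EReal.coe_neg, ← Real.log_exp (-γ), ← ENNReal.log_ofReal_of_pos (Real.exp_pos _),
      ENNReal.log_lt_log_iff, ENNReal.ofReal_lt_ofReal_iff (Real.exp_pos _)] at h
    exact h
  have h3 : Real.exp (-γ) ≤ 1 := Real.exp_le_one_iff.2 (by linarith)
  refine ⟨η, hη.1.lt_of_ne ?_, hη.2.lt_of_ne ?_, h2.le⟩
  · rintro rfl
    simp [hq.2] at h2
    linarith
  · rintro rfl
    simp [hp.2] at h2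
    linarith

lemma exp_neg_le_affinity {c : ℝ} (h : chernoff p q ≤ c) {η : ℝ} (hη : η ∈ Set.Icc (0 : ℝ) 1) :
    Real.exp (-c) ≤ ∑ a, p a ^ η * q a ^ (1 - η) := by
  rw [chernoff, EReal.neg_le] at h
  have h2 := h.trans (iInf₂_le η hη)
  rw [← EReal.coe_neg, ← Real.log_exp (-c), ← ENNReal.log_ofReal_of_pos (Real.exp_pos _),
      ENNReal.log_le_log_iff] at h2
  by_contra! h3
  exact h2.not_gt ((ENNReal.ofReal_lt_ofReal_iff (Real.exp_pos _)).2 h3)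

lemma hasDerivAt_sum_tilt (s : ℝ) : HasDerivAt (fun s => ∑ a, tilt p q s a)
    (∑ a, tilt p q s a * Real.log (p a / q a)) s := by
  refine HasDerivAt.fun_sum fun a _ => ?_
  have := (((hasDerivAt_id s).mul_const (Real.log (p a / q a))).exp).const_mul (commonPart p q a)
  refine HasDerivAt.congr_deriv (f := fun s => tilt p q s a) this ?_
  simp only [tilt, id]
  ring

lemma continuous_sum_tilt : Continuous fun s => ∑ a, tilt p q s a :=
  continuous_iff_continuousAt.2 fun s => (hasDerivAt_sum_tilt s).continuousAt

lemma sum_tilt_eq_affinity (hp : ∀ a, 0 ≤ p a) (hq : ∀ a, 0 ≤ q a) {s : ℝ}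
    (hs : s ∈ Set.Ioo (0 : ℝ) 1) : ∑ a, p a ^ s * q a ^ (1 - s) = ∑ a, tilt p q s a := by
  refine Finset.sum_congr rfl fun a _ => rpow_mul_rpow_eq_tilt hp hq ?_
  rintro (h | h)
  · rw [h, Real.zero_rpow hs.1.ne', zero_mul]
  · rw [h, Real.zero_rpow (sub_pos.2 hs.2).ne', mul_zero]

lemma sum_tilt_eq_affinity_of_support (hp : ∀ a, 0 ≤ p a) (hq : ∀ a, 0 ≤ q a)
    (hpq : ∀ a, p a = 0 ↔ q a = 0) (s : ℝ) :
    ∑ a, p a ^ s * q a ^ (1 - s) = ∑ a, tilt p q s a := by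
  refine Finset.sum_congr rfl fun a _ => rpow_mul_rpow_eq_tilt hp hq fun h => ?_
  rw [(hpq a), or_self] at h
  rw [(hpq a).2 h, h]
  rcases eq_or_ne s 0 with rfl | hs
  · simp
  · rw [Real.zero_rpow hs, zero_mul]

/-- At the endpoints `0 ^ 0 = 1` can make the affinity exceed the tilted sum, so the bound is
carried over from the open interval by continuity. -/
lemma exp_neg_le_sum_tilt (hp : ∀ a, 0 ≤ p a) (hq : ∀ a, 0 ≤ q a) {c : ℝ}
    (h : chernoff p q ≤ c) {s : ℝ} (hs : s ∈ Set.Icc (0 : ℝ) 1) :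
    Real.exp (-c) ≤ ∑ a, tilt p q s a := by
  have hcl : s ∈ closure (Set.Ioo (0 : ℝ) 1) := by rwa [closure_Ioo zero_ne_one]
  refine closure_minimal (s := Set.Ioo (0 : ℝ) 1)
    (t := {s | Real.exp (-c) ≤ ∑ a, tilt p q s a}) (fun s hs => ?_)
    (isClosed_le continuous_const continuous_sum_tilt) hcl
  rw [Set.mem_ofPred_eq, ← sum_tilt_eq_affinity hp hq hs]
  exact exp_neg_le_affinity h (Set.Ioo_subset_Icc_self hs)

/-- A distribution whose divergences from `p` and `q` are at most the Chernoff information. -/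
lemma exists_kl_le_of_chernoff_le (hp : ∀ a, 0 ≤ p a) (hq : ∀ a, 0 ≤ q a) {c : ℝ}
    (h : chernoff p q ≤ c) :
    ∃ Q ∈ stdSimplex ℝ X, (∀ a, p a = 0 → Q a = 0) ∧ (∀ a, q a = 0 → Q a = 0) ∧
      kl Q p ≤ c ∧ kl Q q ≤ c := by
  obtain ⟨s, hs, hmin⟩ := isCompact_Icc.exists_isMinOn (Set.nonempty_Icc.2 zero_le_one)
    (continuous_sum_tilt (p := p) (q := q)).continuousOn
  set G := ∑ a, tilt p q s a with hG
  set E := ∑ a, tilt p q s a * Real.log (p a / q a) with hE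
  have hGc : Real.exp (-c) ≤ G := exp_neg_le_sum_tilt hp hq h hs
  have hG0 : 0 < G := (Real.exp_pos _).trans_le hGc
  have hlog : -Real.log G ≤ c := by
    have := Real.log_le_log (Real.exp_pos _) hGc
    rw [Real.log_exp] at this
    linarith
  -- First-order optimality on `[0, 1]`, with `E` the derivative at `s`. The one-sided conditions
  -- also cover a minimiser at an endpoint, where `E` need not vanish.
  have hdir : ∀ y ∈ Set.Icc (0 : ℝ) 1, 0 ≤ (y - s) * E := fun y hy => by
    have := hmin.localize.hasFDerivWithinAt_nonneg
      (hasDerivAt_sum_tilt (p := p) (q := q) s).hasFDerivAt.hasFDerivWithinAt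
      (sub_mem_posTangentConeAt_of_segment_subset ((convex_Icc 0 1).segment_subset hs hy))
    simpa using this
  have hE0 : 0 ≤ -s * E := by simpa using hdir 0 ⟨le_rfl, zero_le_one⟩
  have hE1 : 0 ≤ (1 - s) * E := hdir 1 ⟨zero_le_one, le_rfl⟩
  have ht0 : ∀ a, 0 ≤ tilt p q s a := fun a => by
    have := hq a
    unfold tilt commonPart
    split_ifs <;> positivity
  have hsum : ∑ a, tilt p q s a / G = 1 := by rw [← Finset.sum_div, div_self hG0.ne']
  have hzero : ∀ a, p a = 0 ∨ q a = 0 → tilt p q s a = 0 := fun a ha => by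
    simp [tilt, commonPart, ha]
  -- One computation for both divergences: `r = p` has `b = -1` and `r = q` has `b = 0`.
  have hkl : ∀ (r : X → ℝ) (b : ℝ), (∀ a, ¬ (p a = 0 ∨ q a = 0) →
      Real.log (q a / r a) = b * Real.log (p a / q a)) → (∀ a, r a = 0 → p a = 0 ∨ q a = 0) →
      kl (fun a => tilt p q s a / G) r = (s + b) * E / G - Real.log G := fun r b hb hr => by
    calc kl (fun a => tilt p q s a / G) r = ∑ a, ((s + b) / G *
          (tilt p q s a * Real.log (p a / q a)) - Real.log G * (tilt p q s a / G)) := by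
          refine Finset.sum_congr rfl fun a _ => ?_
          by_cases ha : p a = 0 ∨ q a = 0
          · simp [hzero a ha]
          · have hr0 : r a ≠ 0 := fun e => ha (hr a e)
            have hq0 : q a ≠ 0 := fun e => ha (Or.inr e)
            have h1 : tilt p q s a / G / r a
                = q a / r a * Real.exp (s * Real.log (p a / q a)) / G := by
              simp only [tilt, commonPart, if_neg ha]; ring
            rw [h1, Real.log_div (mul_ne_zero (div_ne_zero hq0 hr0) (Real.exp_ne_zero _)) hG0.ne',
              Real.log_mul (div_ne_zero hq0 hr0) (Real.exp_ne_zero _), Real.log_exp, hb a ha]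
            ring
      _ = _ := by
          rw [Finset.sum_sub_distrib, ← Finset.mul_sum, ← Finset.mul_sum, hsum, ← hE]
          ring
  refine ⟨fun a => tilt p q s a / G, ⟨fun a => div_nonneg (ht0 a) hG0.le, hsum⟩,
    fun a ha => by simp [hzero a (Or.inl ha)], fun a ha => by simp [hzero a (Or.inr ha)], ?_, ?_⟩
  · rw [hkl p (-1) (fun a ha => ?_) fun a ha => Or.inl ha]
    · have : (s + -1) * E / G ≤ 0 := div_nonpos_of_nonpos_of_nonneg (by linarith) hG0.le
      linarith
    · rw [← inv_div, Real.log_inv]; ring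
  · rw [hkl q 0 (fun a ha => ?_) fun a ha => Or.inr ha]
    · have : (s + 0) * E / G ≤ 0 := div_nonpos_of_nonpos_of_nonneg (by linarith) hG0.le
      linarith
    · rw [div_self fun e => ha (Or.inr e)]; simp

/-- For equal supports the infimum defining the Chernoff information is attained. -/
lemma exists_chernoff_eq (hp : ∀ a, 0 ≤ p a) (hq : q ∈ stdSimplex ℝ X)
    (hpq : ∀ a, p a = 0 ↔ q a = 0) :
    ∃ η ∈ Set.Icc (0 : ℝ) 1, 0 < ∑ a, p a ^ η * q a ^ (1 - η) ∧
      chernoff p q = ((-Real.log (∑ a, p a ^ η * q a ^ (1 - η)) : ℝ) : EReal) := by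
  obtain ⟨η, hη, hmin⟩ := isCompact_Icc.exists_isMinOn (Set.nonempty_Icc.2 zero_le_one)
    (continuous_sum_tilt (p := p) (q := q)).continuousOn
  have hpos : 0 < ∑ a, p a ^ η * q a ^ (1 - η) := by
    obtain ⟨a, -, ha⟩ : ∃ a ∈ Finset.univ, 0 < q a := Finset.exists_lt_of_sum_lt (by
      rw [hq.2, Finset.sum_const_zero]; exact one_pos)
    have hpa : 0 < p a := (hp a).lt_of_ne fun e => ha.ne' ((hpq a).1 e.symm)
    exact Finset.sum_pos' (fun a _ => mul_nonneg (Real.rpow_nonneg (hp a) _)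
      (Real.rpow_nonneg (hq.1 a) _)) ⟨a, Finset.mem_univ a,
      mul_pos (Real.rpow_pos_of_pos hpa _) (Real.rpow_pos_of_pos ha _)⟩
  refine ⟨η, hη, hpos, ?_⟩
  rw [chernoff, EReal.coe_neg, ← ENNReal.log_ofReal_of_pos hpos]
  refine congrArg Neg.neg (le_antisymm (iInf₂_le η hη) (le_iInf₂ fun s hs => ?_))
  refine ENNReal.log_monotone (ENNReal.ofReal_le_ofReal ?_)
  rw [sum_tilt_eq_affinity_of_support hp hq.1 hpq, sum_tilt_eq_affinity_of_support hp hq.1 hpq]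
  exact hmin hs

/-- With a non-strict bound it is `γ > 0` that excludes the endpoints. -/
lemma exists_affinity_le_of_le_chernoff (hp : p ∈ stdSimplex ℝ X) (hq : q ∈ stdSimplex ℝ X)
    (hpq : ∀ a, p a = 0 ↔ q a = 0) {γ : ℝ} (h0 : 0 < γ) (h : (γ : EReal) ≤ chernoff p q) :
    ∃ η : ℝ, 0 < η ∧ η < 1 ∧ ∑ a, p a ^ η * q a ^ (1 - η) ≤ Real.exp (-γ) := by
  obtain ⟨η, hη, hpos, heq⟩ := exists_chernoff_eq hp.1 hq hpq
  rw [heq, EReal.coe_le_coe_iff, le_neg] at h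
  have h2 : ∑ a, p a ^ η * q a ^ (1 - η) ≤ Real.exp (-γ) := (Real.log_le_iff_le_exp hpos).1 h
  have h3 : Real.exp (-γ) < 1 := Real.exp_lt_one_iff.2 (by linarith)
  refine ⟨η, hη.1.lt_of_ne ?_, hη.2.lt_of_ne ?_, h2⟩
  · rintro rfl
    simp [hq.2] at h2
    linarith
  · rintro rfl
    simp [hp.2] at h2
    linarith

lemma kl_eq_sum_mul_log {p r : X → ℝ} (h : ∀ a, r a = 0 → p a = 0) :
    kl p r = ∑ a, r a * (p a / r a * Real.log (p a / r a)) :=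
  Finset.sum_congr rfl fun a _ => by
    by_cases hr : r a = 0
    · simp [hr, h a hr]
    · field_simp

/-- Pointwise convexity of `u log u` at the ratios to `r`, weighted by `r`. -/
lemma kl_convex {Q p r : X → ℝ} (hQ : ∀ a, 0 ≤ Q a) (hp : ∀ a, 0 ≤ p a) (hr : ∀ a, 0 ≤ r a)
    (hQr : ∀ a, r a = 0 → Q a = 0) (hpr : ∀ a, r a = 0 → p a = 0) {t : ℝ} (h0 : 0 ≤ t)
    (h1 : t ≤ 1) :
    kl (fun a => (1 - t) * Q a + t * p a) r ≤ (1 - t) * kl Q r + t * kl p r := by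
  rw [kl_eq_sum_mul_log hQr, kl_eq_sum_mul_log hpr,
    kl_eq_sum_mul_log (fun a ha => by simp [hQr a ha, hpr a ha]), Finset.mul_sum, Finset.mul_sum,
    ← Finset.sum_add_distrib]
  refine Finset.sum_le_sum fun a _ => ?_
  have := Real.convexOn_mul_log.2 (x := Q a / r a) (y := p a / r a)
    (Set.mem_Ici.2 (div_nonneg (hQ a) (hr a)))
    (Set.mem_Ici.2 (div_nonneg (hp a) (hr a))) (sub_nonneg.2 h1) h0 (by ring)
  simp only [smul_eq_mul] at this
  have h2 : ((1 - t) * Q a + t * p a) / r a = (1 - t) * (Q a / r a) + t * (p a / r a) := by ring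
  rw [h2]
  refine (mul_le_mul_of_nonneg_left this (hr a)).trans (le_of_eq ?_)
  ring

lemma kl_self (p : X → ℝ) : kl p p = 0 :=
  Finset.sum_eq_zero fun a _ => by
    by_cases h : p a = 0
    · simp [h]
    · simp [div_self h]

end ChernoffInformation

/-! ### Assembly, and the threshold equal to the smallest Chernoff information. -/

section Main

variable {X : Type*} [Fintype X] {M : ℕ} {P : Fin M → X → ℝ} {prior : Fin M → ℝ}

lemma bayesianExponent_le_chernoff (hP : ∀ i, P i ∈ stdSimplex ℝ X)
    (hprior : ∀ i, 0 < prior i) {i j : Fin M} (hij : i ≠ j) {γ : ℝ}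
    (h : chernoff (P i) (P j) < γ) :
    bayesianExponent P prior γ ≤ chernoff (P i) (P j) := by
  have h0 := chernoff_nonneg (p := P i) (hP j)
  obtain ⟨c, hc⟩ : ∃ c : ℝ, (c : EReal) = chernoff (P i) (P j) :=
    ⟨_, EReal.coe_toReal (h.trans (EReal.coe_lt_top γ)).ne
      (EReal.bot_lt_zero.trans_le h0).ne'⟩
  obtain ⟨Q, hQ, hQi, hQj, hki, hkj⟩ := exists_kl_le_of_chernoff_le (hP i).1 (hP j).1 hc.ge
  rw [← hc] at h ⊢
  exact (bayesianExponent_le_kl hP hprior hij hQ hQi hQj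
    (hki.trans_lt (EReal.coe_lt_coe_iff.1 h))).trans (EReal.coe_le_coe_iff.2 hkj)

lemma minChernoff_le {i j : Fin M} (hij : i ≠ j) : minChernoff P ≤ chernoff (P i) (P j) :=
  iInf_le_of_le i (iInf_le_of_le j (iInf_le _ hij))

lemma minChernoff_nonneg (hP : ∀ i, P i ∈ stdSimplex ℝ X) : 0 ≤ minChernoff P :=
  le_iInf fun _ => le_iInf fun j => le_iInf fun _ => chernoff_nonneg (hP j)

lemma bayesianExponent_le_minChernoff (hP : ∀ i, P i ∈ stdSimplex ℝ X)
    (hprior : ∀ i, 0 < prior i) {γ : ℝ} (h : minChernoff P < γ) :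
    bayesianExponent P prior γ ≤ minChernoff P := by
  obtain ⟨i, hi⟩ := iInf_lt_iff.1 h
  obtain ⟨j, hj⟩ := iInf_lt_iff.1 hi
  obtain ⟨hij, hlt⟩ := iInf_lt_iff.1 hj
  refine le_iInf fun k => le_iInf fun l => le_iInf fun hkl => ?_
  -- The converse applies only to pairs below `γ`; for the others the bound from the pair `(i, j)`
  -- is already stronger.
  rcases lt_or_ge (chernoff (P k) (P l)) γ with h1 | h1
  · exact bayesianExponent_le_chernoff hP hprior hkl h1
  · exact (bayesianExponent_le_chernoff hP hprior hij hlt).trans (hlt.le.trans h1)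

lemma exists_minChernoff_eq (hM : 2 ≤ M) (P : Fin M → X → ℝ) :
    ∃ i j : Fin M, i ≠ j ∧ minChernoff P = chernoff (P i) (P j) := by
  have : Nonempty {ij : Fin M × Fin M // ij.1 ≠ ij.2} :=
    ⟨⟨(⟨0, by omega⟩, ⟨1, by omega⟩), by simp⟩⟩
  obtain ⟨ij, h⟩ := exists_eq_ciInf_of_finite
    (f := fun ij : {ij : Fin M × Fin M // ij.1 ≠ ij.2} => chernoff (P ij.1.1) (P ij.1.2))
  refine ⟨ij.1.1, ij.1.2, ij.2, le_antisymm (minChernoff_le ij.2) ?_⟩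
  rw [h]
  exact le_iInf fun k => le_iInf fun l => le_iInf fun hkl =>
    iInf_le_of_le ⟨(k, l), hkl⟩ le_rfl

/-- With threshold zero every class crosses at once, so that the test always errs. -/
lemma errProb_zero (hP : ∀ i, P i ∈ stdSimplex ℝ X) {N : ℕ} (hN : 1 ≤ N) (i : Fin M) :
    errProb P 0 N i = 1 := by
  rw [← sum_weight_eq_one (N := N) (L := N ^ 2) hP i]
  refine Finset.sum_congr rfl fun x _ => Finset.sum_congr rfl fun y _ => if_pos ?_
  have hL : 1 ≤ N ^ 2 := Nat.one_le_pow _ _ hN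
  have hT : 1 ≤ stopTime 0 x y := by
    have hmem : stopTime 0 x y ∈ insert (N ^ 2)
        {n : ℕ | 1 ≤ n ∧ M - 1 ≤ (crossed 0 x y n).card} :=
      Nat.sInf_mem (Set.insert_nonempty _ _)
    rcases hmem with h | h
    · rw [h]; exact hL
    · exact h.1
  have hc : i ∈ crossed 0 x y (stopTime 0 x y) := by
    simp only [crossed, Finset.mem_filter, Finset.mem_univ, true_and]
    refine ⟨1, le_rfl, hT, ?_⟩
    rw [zero_mul]
    exact pairScore_nonneg (x i) y hN le_rfl hL
  intro h
  have : i ∈ decision 0 x y := h ▸ Finset.mem_singleton_self i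
  simp [decision, hc] at this

lemma bayesianExponent_zero_le (hP : ∀ i, P i ∈ stdSimplex ℝ X) (hsum : ∑ i, prior i = 1) :
    bayesianExponent P prior 0 ≤ 0 := by
  refine liminf_le_of_eventually_exp_le (D := 0) fun δ hδ => ?_
  filter_upwards [eventually_ge_atTop 1] with N hN
  simp only [bayesErr, errProb_zero hP hN, mul_one, hsum]
  refine Real.exp_le_one_iff.2 ?_
  have : (0 : ℝ) ≤ N := by positivity
  nlinarith

/-- The tilted `Q` may have divergence exactly `γ` from `P i`, while the converse needs less. Mixing
in weight `t` of `P i` scales that bound by `1 - t` and raises the one from `P j` by at most `t *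
|kl (P i) (P j)|`; then `t` tends to zero. -/
lemma bayesianExponent_chernoff_le (hP : ∀ i, P i ∈ stdSimplex ℝ X)
    (hprior : ∀ i, 0 < prior i) (hsupp : ∀ i j x, P i x = 0 → P j x = 0) {i j : Fin M}
    (hij : i ≠ j) {γ : ℝ} (hγ : 0 < γ) (h : chernoff (P i) (P j) = γ) :
    bayesianExponent P prior γ ≤ γ := by
  obtain ⟨Q, hQ, hQi, hQj, hki, hkj⟩ := exists_kl_le_of_chernoff_le (hP i).1 (hP j).1 h.le
  have key : ∀ t : ℝ, 0 < t → t < 1 →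
      bayesianExponent P prior γ ≤ ((γ + t * |kl (P i) (P j)| : ℝ) : EReal) := fun t h0 h1 => by
    have hQt : (fun a => (1 - t) * Q a + t * P i a) ∈ stdSimplex ℝ X :=
      convex_stdSimplex ℝ X hQ (hP i) (sub_nonneg.2 h1.le) h0.le (by ring)
    have hb := kl_convex hQ.1 (hP i).1 (hP i).1 hQi (fun _ h => h) h0.le h1.le
    have hc := kl_convex hQ.1 (hP i).1 (hP j).1 hQj (hsupp j i) h0.le h1.le
    rw [kl_self, mul_zero, add_zero] at hb
    refine (bayesianExponent_le_kl hP hprior hij hQt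
      (fun a ha => by simp [hQi a ha, ha]) (fun a ha => by simp [hQj a ha, hsupp j i a ha])
      (hb.trans_lt ?_)).trans (EReal.coe_le_coe_iff.2 (hc.trans ?_))
    · nlinarith
    · have := le_abs_self (kl (P i) (P j))
      nlinarith
  rw [← EReal.le_of_forall_lt_iff_le]
  intro z hz
  rw [EReal.coe_lt_coe_iff] at hz
  set K := |kl (P i) (P j)|
  have hK : 0 ≤ K := abs_nonneg _
  obtain ⟨t, h0, h1, h2⟩ : ∃ t : ℝ, 0 < t ∧ t < 1 ∧ t * (K + 1) ≤ z - γ :=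
    ⟨min (1 / 2) ((z - γ) / (K + 1)), lt_min (by norm_num) (div_pos (by linarith) (by linarith)),
      (min_le_left _ _).trans_lt (by norm_num),
      (le_div_iff₀ (by linarith)).1 (min_le_right _ _)⟩
  exact (key t h0 h1).trans (EReal.coe_le_coe_iff.2 (by nlinarith))

end Main

end SeqClass

open SeqClass in
theorem mainTheorem8 {X : Type*} [Fintype X] {M : ℕ} (hM : 2 ≤ M)
    (P : Fin M → X → ℝ) (hP : ∀ i, P i ∈ stdSimplex ℝ X)
    (prior : Fin M → ℝ) (hprior : ∀ i, 0 < prior i) (hsum : ∑ i, prior i = 1) :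
    -- the supremum of the achievable exponents is the smallest Chernoff information
    IsLUB (SeqClass.achievableExponents P prior) (SeqClass.minChernoff P) ∧
    -- every smaller exponent is achievable, with threshold equal to that exponent
    (∀ γ : ℝ, 0 ≤ γ → (γ : EReal) < SeqClass.minChernoff P →
      (γ : EReal) ≤ SeqClass.bayesianExponent P prior γ) ∧
    -- a threshold above the smallest Chernoff information does not give a larger exponent
    (∀ γ : ℝ, SeqClass.minChernoff P < (γ : EReal) →
      SeqClass.bayesianExponent P prior γ ≤ SeqClass.minChernoff P) ∧
    -- if the distributions have a common support, the maximum is attained,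
    -- at the threshold equal to the smallest Chernoff information
    ((∀ i j x, P i x = 0 → P j x = 0) →
      IsGreatest (SeqClass.achievableExponents P prior) (SeqClass.minChernoff P) ∧
      ∃ γ : ℝ, (γ : EReal) = SeqClass.minChernoff P ∧
        SeqClass.bayesianExponent P prior γ = SeqClass.minChernoff P) := by
  have hach : ∀ γ : ℝ, 0 ≤ γ → (γ : EReal) < minChernoff P →
      (γ : EReal) ≤ bayesianExponent P prior γ := fun γ h0 h =>
    le_bayesianExponent hP hprior fun i j hij =>
      exists_affinity_le_of_lt_chernoff (hP i) (hP j) h0 (h.trans_le (minChernoff_le hij))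
  have hconv : ∀ γ : ℝ, minChernoff P < (γ : EReal) →
      bayesianExponent P prior γ ≤ minChernoff P := fun γ h =>
    bayesianExponent_le_minChernoff hP hprior h
  have hub : minChernoff P ∈ upperBounds (achievableExponents P prior) := by
    rintro _ ⟨γ, -, rfl, h⟩
    by_contra! hlt
    exact (h.trans (hconv γ hlt)).not_gt hlt
  refine ⟨⟨hub, fun b hb => ?_⟩, hach, hconv, fun hsupp => ?_⟩
  · rw [← EReal.ge_of_forall_gt_iff_ge]
    intro z hz
    -- The zero threshold is always achievable, which handles negative `z` and the case of vanishing
    -- Chernoff information.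
    rcases lt_or_ge z 0 with h0 | h0
    · have hb0 : ((0 : ℝ) : EReal) ≤ b :=
        hb ⟨0, le_rfl, rfl, bayesianExponent_nonneg hP hprior hsum 0⟩
      exact (EReal.coe_le_coe_iff.2 h0.le).trans hb0
    · exact hb ⟨z, h0, rfl, hach z h0 hz⟩
  · obtain ⟨i, j, hij, hmin⟩ := exists_minChernoff_eq hM P
    obtain ⟨η, -, -, hη⟩ := exists_chernoff_eq (hP i).1 (hP j)
      fun a => ⟨hsupp i j a, hsupp j i a⟩
    obtain ⟨γ, hγ⟩ : ∃ γ : ℝ, (γ : EReal) = minChernoff P := ⟨_, (hmin.trans hη).symm⟩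
    have hγ0 : 0 ≤ γ := EReal.coe_nonneg.1 (hγ ▸ minChernoff_nonneg hP)
    have heq : bayesianExponent P prior γ = minChernoff P := by
      rcases hγ0.eq_or_lt with h0 | h0
      · subst h0
        rw [← hγ]
        exact le_antisymm (bayesianExponent_zero_le hP hsum)
          (bayesianExponent_nonneg hP hprior hsum 0)
      · rw [← hγ]
        refine le_antisymm (bayesianExponent_chernoff_le hP hprior hsupp hij h0
          (hmin.symm.trans hγ.symm)) (le_bayesianExponent hP hprior fun k l hkl => ?_)
        exact exists_affinity_le_of_le_chernoff (hP k) (hP l)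
          (fun a => ⟨hsupp k l a, hsupp l k a⟩) h0 (hγ.trans_le (minChernoff_le hkl))
    exact ⟨⟨⟨γ, hγ0, hγ.symm, (hγ.trans heq.symm).le⟩, hub⟩, γ, hγ, heq⟩
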